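/- Let $f(z)=\|z\|^2$ on $\mathbb C^2$, let $S^3=f^{-1}(1)$, and put $\omega^1=-df\circ i$, $\omega^2=-df\circ j$, $\omega^3=-df\circ k$ (restricted to $S^3$), where $i$ is multiplication by $\sqrt{-1}$, $j(z_0,z_1)=(-\bar z_1,\bar z_0)$ and $k=ij$. Let $\theta=\omega^1$, $\xi=\ker\theta$, $\theta^1=\frac1{\sqrt2}(\omega^2+i\omega^3)$, and for $|t|<1$ let $J_t$ be Rossi's CR structure: the complex structure on $\xi$ for which $$\theta^1_t=\frac1{\sqrt{1-t^2}}\left(\theta^1-t\,\theta^{\bar1}\right)$$ is of type $(1,0)$. Let $J_{\mathrm{std}}$ be the standard CR structure on $S^3$, i.e. multiplication by $i$ on $\xi$. For a pseudohermitian structure $(J,\theta)$ with $\ker\theta=\xi$, let $\theta^1$ be a unitary $(1,0)$-coframe ($d\theta=i\theta^1\wedge\theta^{\bar1}$), and let $\varphi$, $A^1{}_{\bar1}$ and $W$ be the Tanaka--Webster connection form, torsion and curvature, given by $d\theta^1=\theta^1\wedge\varphi+A^1{}_{\bar1}\,\theta\wedge\theta^{\bar1}$, $\varphi+\bar\varphi=0$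 and $d\varphi\equiv W\,\theta^1\wedge\theta^{\bar1}$ mod $\theta$. With dual frame $Z_1,Z_{\bar1}$, the torsion tensor is $A_{J,\theta}=A^1{}_{\bar1}Z_1\otimes\theta^{\bar1}+\overline{A^1{}_{\bar1}}\,Z_{\bar1}\otimes\theta^1$. The normalized torsion flow is $$\partial_sJ_s=2A_{J_s,\theta_s},\qquad \partial_s\theta_s=-2(W-\bar W)\theta_s,\qquad \bar W=\int W\,\theta\wedge d\theta\Big/\int\theta\wedge d\theta .$$ A CR structure is called embeddable if there is a smooth CR embedding into some $\mathbb C^N$. For every $t$ with $|t|<1$ the following hold. 1. $J_t$ exists and is unique, and it is a homogeneous CR structure: the $\omega^i$ form a global coframe with $d\omega^1=\omega^2\wedge\omega^3$, $d\omega^2=-\omega^1\wedge\omega^3$, $d\omega^3=\omega^1\wedge\omega^2$, the form $\omega^1$ is a contact form, and on $\xi$, in terms of the frame $X_1,X_2,X_3$ dual to $\omega^1,\omega^2,\omega^3$, $J_t=J_{a,b,c}$ with $a=0$, $b=1$, $c=\frac{1-t}{1+t}$, where $$J_{a,b,c}=aX_2\otimes\omega^2+cX_3\otimes\omega^2-\tfrac{1+a^2}{c}X_2\otimes\omega^3-aX_3\otimes\omega^3$$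 is the complex structure of the pseudohermitian structure with contact form $b^2\omega^1$. 2. If $t>0$, then $J_t$ is not embeddable. 3. $J_{\mathrm{std}}$ is a strictly pseudoconvex CR structure on $S^3$, and it is embeddable. 4. For every constant $b>0$ there is a solution $(J_s,\theta_s)$, $s\in[0,\infty)$, of the normalized torsion flow with initial value $(J_t,b^2\omega^1)$ consisting of homogeneous CR structures $(J_{a_s,b_s,c_s},b_s^2\omega^1)$ with $a_s\in\mathbb R$ and $b_s,c_s>0$ constant on $S^3$. Every solution of this kind with the same initial value on an interval $[0,T)$ agrees with it there. As $s\to\infty$, $(J_s,\theta_s)$ converges in $C^\infty$ to $(J_{\mathrm{std}},b^2\omega^1)$. -/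

import Mathlib

open scoped Manifold ContDiff
open Filter Topology MeasureTheory Metric

noncomputable section

/-! ## The three-sphere in `ℂ²` -/

/-- `ℂ²` with its Euclidean norm. -/
abbrev C2 : Type := EuclideanSpace ℂ (Fin 2)

instance factFinrankC2 : Fact (Module.finrank ℝ C2 = 3 + 1) := ⟨by
  have h := Module.finrank_mul_finrank ℝ ℂ C2
  rw [Complex.finrank_real_complex, finrank_euclideanSpace_fin] at h
  omega⟩

/-- The unit sphere `S³ ⊂ ℂ²`, with Mathlib's structure of a smooth 3-manifold. -/
abbrev S3 : Type := sphere (0 : C2) 1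

/-- The antilinear map `j (z₀, z₁) = (-z̄₁, z̄₀)`. -/
def quatJ : C2 →L[ℝ] C2 := LinearMap.toContinuousLinearMap
  { toFun := fun z => !₂[-(starRingEnd ℂ) (z 1), (starRingEnd ℂ) (z 0)]
    map_add' := fun z w => by ext i; fin_cases i <;> simp [add_comm]
    map_smul' := fun r z => by ext i; fin_cases i <;> simp }

/-- Multiplication by the complex number `i`. -/
def quatI : C2 →L[ℝ] C2 := (Complex.I • ContinuousLinearMap.id ℂ C2).restrictScalars ℝ

/-- The quaternion units `i`, `j`, `k = i j` acting on `ℂ² = ℍ`. -/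
def quat : Fin 3 → C2 →L[ℝ] C2 := ![quatI, quatJ, quatI.comp quatJ]

/-- The tangent space `T_p S³ = {v ∈ ℂ² : Re ⟨p, v⟩ = 0}`. -/
def tangent (p : S3) : Submodule ℝ C2 := LinearMap.ker (innerSL ℝ (p : C2)).toLinearMap

/-- The radial retraction `x ↦ x / ‖x‖` of `ℂ² \ {0}` onto `S³` (with a dummy value at `0`). -/
def retr (x : C2) : S3 := by
  classical
  exact if h : x = 0 then ⟨EuclideanSpace.single 0 1, by simp⟩
    else ⟨(‖x‖⁻¹ : ℝ) • x, by
      rw [mem_sphere_zero_iff_norm, norm_smul, norm_inv, norm_norm,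
        inv_mul_cancel₀ (norm_ne_zero_iff.mpr h)]⟩

/-! ## Functions and 1-forms on the sphere

A 1-form is represented by a map `p ↦ (η p : ℂ² → F)`; only the restriction of `η p` to
`tangent p` has a meaning, and every notion below depends on that restriction only. Smoothness of
maps on `S³` is Mathlib's `ContMDiff` for the manifold `S³`. -/

/-- `F`-valued 1-forms on `S³`. -/
abbrev Form (F : Type) [NormedAddCommGroup F] [NormedSpace ℝ F] : Type := S3 → C2 →L[ℝ] F

/-- Fields of endomorphisms. -/
abbrev Endo : Type := S3 → C2 →L[ℝ] C2

/-- A smooth map on `S³`. -/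
def SmoothS3 {V : Type} [NormedAddCommGroup V] [NormedSpace ℝ V] (f : S3 → V) : Prop :=
  ContMDiff (𝓡 3) 𝓘(ℝ, V) ∞ f

/-- The differential of a map on the sphere: `fnD f p v = df_p(v)` for `v ∈ T_p S³`. -/
def fnD {V : Type} [NormedAddCommGroup V] [NormedSpace ℝ V] (f : S3 → V) (p : S3) : C2 →L[ℝ] V :=
  fderiv ℝ (fun x => f (retr x)) (p : C2)

section Forms

variable {F : Type} [NormedAddCommGroup F] [NormedSpace ℝ F]

/-- The pull-back of a 1-form under the retraction, a 1-form on `ℂ² \ {0}`. -/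
def pull (η : Form F) (x : C2) : C2 →L[ℝ] F :=
  (η (retr x)).comp (fderiv ℝ (fun y => (retr y : C2)) x)

/-- The exterior derivative `dη_p(u, v)` for `u, v ∈ T_p S³`. As `d` commutes with pull-backs and
the retraction is the identity on `S³`, it is the exterior derivative of `pull η` on tangent
vectors of `S³`. -/
def extD (η : Form F) (p : S3) (u v : C2) : F :=
  fderiv ℝ (pull η) (p : C2) u v - fderiv ℝ (pull η) (p : C2) v u

end Forms

/-- Wedge product of two real 1-forms. -/
def wedgeR (η ζ : Form ℝ) (p : S3) (u v : C2) : ℝ := η p u * ζ p v - η p v * ζ p u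

/-- Wedge product of two complex 1-forms. -/
def wedgeC (η ζ : Form ℂ) (p : S3) (u v : C2) : ℂ := η p u * ζ p v - η p v * ζ p u

/-- The complex conjugate 1-form. -/
def conjForm (η : Form ℂ) : Form ℂ := fun p => Complex.conjCLE.toContinuousLinearMap.comp (η p)

/-- A real 1-form as a complex one. -/
def toC (η : Form ℝ) : Form ℂ := fun p => Complex.ofRealCLM.comp (η p)

/-- The function `(θ ∧ dθ)(e₁, e₂, e₃)`, where `e₁ = i p, e₂ = j p, e₃ = k p` is the standard
orthonormal frame of `T_p S³`. -/
def contactDensity (θ : Form ℝ) (p : S3) : ℝ :=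
  θ p (quat 0 p) * extD θ p (quat 1 p) (quat 2 p)
    + θ p (quat 1 p) * extD θ p (quat 2 p) (quat 0 p)
    + θ p (quat 2 p) * extD θ p (quat 0 p) (quat 1 p)

/-- A contact form: a smooth 1-form with `θ ∧ dθ ≠ 0` everywhere. -/
def IsContact (θ : Form ℝ) : Prop := SmoothS3 θ ∧ ∀ p, contactDensity θ p ≠ 0

/-- The mean value `∫ W θ∧dθ / ∫ θ∧dθ`. A 3-form is integrated by integrating its value on an
orthonormal frame against the surface measure of the sphere. -/
def mean (θ : Form ℝ) (W : S3 → ℝ) : ℝ :=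
  (∫ p, W p * contactDensity θ p ∂((volume : Measure C2).toSphere))
    / (∫ p, contactDensity θ p ∂((volume : Measure C2).toSphere))

/-! ## The standard coframe, contact structure and CR structures -/

/-- The forms `ω¹ = -df ∘ i`, `ω² = -df ∘ j`, `ω³ = -df ∘ k`, for `f(z) = ‖z‖²`. -/
def stdCoframe (i : Fin 3) : Form ℝ := fun p =>
  -((fderiv ℝ (fun z : C2 => ‖z‖ ^ 2) (p : C2)).comp (quat i))

/-- The contact plane `ξ_p = T_p S³ ∩ ker ω¹_p`. -/
def xi (p : S3) : Submodule ℝ C2 := tangent p ⊓ LinearMap.ker (stdCoframe 0 p).toLinearMap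

/-- `J` is a smooth field of endomorphisms of `ξ`, extended to `ℂ² = ξ_p ⊕ ℂ p` by zero on `ℂ p`;
thus two such fields are equal as soon as they agree on `ξ`. -/
structure IsXiEndo (J : Endo) : Prop where
  smooth : SmoothS3 J
  maps_xi : ∀ p, ∀ v ∈ xi p, J p v ∈ xi p
  normal : ∀ p, J p p = 0 ∧ J p (quat 0 p) = 0

/-- A CR structure on `ξ` (integrability is automatic in dimension 3). -/
structure IsCR (J : Endo) : Prop extends IsXiEndo J where
  sq : ∀ p, ∀ v ∈ xi p, J p (J p v) = -v

/-- `(θ, J)` is a (strictly pseudoconvex) pseudohermitian structure with contact structure `ξ`. The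
condition `θ p p = 0` is no restriction on the 1-form: it only fixes its representative. -/
structure IsPseudohermitian (J : Endo) (θ : Form ℝ) : Prop where
  cr : IsCR J
  contact : IsContact θ
  normal : ∀ p, θ p p = 0
  ker_eq : ∀ p, ∀ v ∈ tangent p, θ p v = 0 ↔ v ∈ xi p
  pos : ∀ p, ∀ v ∈ xi p, v ≠ 0 → 0 < extD θ p v (J p v)

/-- The standard CR structure: multiplication by `i` on `ξ`. -/
def stdJ : Endo := fun p =>
  (Complex.I • (ContinuousLinearMap.id ℂ C2
    - (innerSL ℂ (p : C2)).smulRight (p : C2))).restrictScalars ℝ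

/-- CR embeddability into some `ℂ^N`: there is a smooth embedding whose differential is
complex linear on `(ξ, J)`. -/
def IsEmbeddable (J : Endo) : Prop :=
  ∃ (N : ℕ) (f : S3 → EuclideanSpace ℂ (Fin N)),
    SmoothS3 f ∧ IsEmbedding f ∧ (∀ p, ∀ v ∈ tangent p, fnD f p v = 0 → v = 0) ∧
    ∀ p, ∀ v ∈ xi p, fnD f p (J p v) = Complex.I • fnD f p v

/-- The admissible form `θ¹ = (ω² + i ω³)/√2` of the standard structure. -/
def stdTheta1 : Form ℂ := fun p =>
  ((Real.sqrt 2)⁻¹ : ℝ) • (toC (stdCoframe 1) p + Complex.I • toC (stdCoframe 2) p)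

/-- The deformed form `θ¹_t = (θ¹ - t θ^{1̄})/√(1 - t²)`. -/
def rossiTheta1 (t : ℝ) : Form ℂ := fun p =>
  ((Real.sqrt (1 - t ^ 2))⁻¹ : ℝ) • (stdTheta1 p - t • conjForm stdTheta1 p)

/-- `J` is Rossi's CR structure with parameter `t`: the one for which `θ¹_t` is of type `(1,0)`. -/
def IsRossi (t : ℝ) (J : Endo) : Prop :=
  IsCR J ∧ ∀ p, ∀ v ∈ xi p, rossiTheta1 t p (J p v) = Complex.I * rossiTheta1 t p v

/-! ## Homogeneous CR structures -/

/-- A homogeneous contact manifold structure on `S³`: a global coframe `η` with constant structure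
coefficients `C i j k` (for `j < k`) and a contact form with constant coefficients in it. -/
structure IsHomogeneousContact (η : Fin 3 → Form ℝ) (C : Fin 3 → Fin 3 → Fin 3 → ℝ)
    (θ : Form ℝ) : Prop where
  smooth : ∀ i, SmoothS3 (η i)
  basis : ∀ p, ∀ v ∈ tangent p, (∀ i, η i p v = 0) → v = 0
  structure_eq : ∀ i p, ∀ u ∈ tangent p, ∀ v ∈ tangent p,
    extD (η i) p u v = ∑ j, ∑ k, if j < k then C i j k * wedgeR (η j) (η k) p u v else 0
  combination : ∃ e : Fin 3 → ℝ, ∀ p, ∀ v ∈ tangent p, θ p v = ∑ i, e i * η i p v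
  contact : IsContact θ

/-- The normalization of the coframe: `c¹₂₃ = 1` and `c¹₁₂ = c¹₁₃ = c²₁₂ = c³₁₃ = 0`. -/
def IsNormalized (C : Fin 3 → Fin 3 → Fin 3 → ℝ) : Prop :=
  C 0 1 2 = 1 ∧ C 0 0 1 = 0 ∧ C 0 0 2 = 0 ∧ C 1 0 1 = 0 ∧ C 2 0 2 = 0

/-- `(J, θ)` is the homogeneous CR structure `(J_{abc}, b² η¹)` for the normalized coframe `η`:
`J = a X₂⊗η² + c X₃⊗η² - ((1+a²)/c) X₂⊗η³ - a X₃⊗η³` on `ξ = ker η¹`, where `X` is dual to `η`. -/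
structure IsHomogeneousCR (η : Fin 3 → Form ℝ) (C : Fin 3 → Fin 3 → Fin 3 → ℝ) (a b c : ℝ)
    (J : Endo) (θ : Form ℝ) : Prop where
  homogeneous : IsHomogeneousContact η C (η 0)
  normalized : IsNormalized C
  b_pos : 0 < b
  c_pos : 0 < c
  form_eq : ∀ p, ∀ v ∈ tangent p, θ p v = b ^ 2 * η 0 p v
  pseudohermitian : IsPseudohermitian J θ
  coeff_two : ∀ p, ∀ v ∈ xi p, η 1 p (J p v) = a * η 1 p v - (1 + a ^ 2) / c * η 2 p v
  coeff_three : ∀ p, ∀ v ∈ xi p, η 2 p (J p v) = c * η 1 p v - a * η 2 p v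

/-- The structure coefficients `c¹₂₃ = 1, c²₁₃ = -1, c³₁₂ = 1`, all others (with `j < k`) zero. -/
def stdC (i j k : Fin 3) : ℝ :=
  if (i, j, k) = (0, 1, 2) ∨ (i, j, k) = (2, 0, 1) then 1
  else if (i, j, k) = (1, 0, 2) then -1 else 0

/-! ## Tanaka-Webster torsion and curvature, and the normalized torsion flow -/

/-- `A` and `W` are the torsion tensor and the Webster curvature of the Tanaka-Webster connection of
`(J, θ)`, computed from a unitary coframe `θ¹` of type `(1,0)`, which exists globally on `S³`
(the result does not depend on its choice):
`dθ = i θ¹∧θ^{1̄}`, `dθ¹ = θ¹∧φ + a θ∧θ^{1̄}`, `φ + φ̄ = 0`, `dφ = W θ¹∧θ^{1̄} mod θ`, where `φ` is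
the connection form `ω₁¹` and `a` is the component `A¹_{1̄}`; and `A = a Z₁⊗θ^{1̄} + ā Z_{1̄}⊗θ¹`,
which as a real endomorphism of `ξ` is given by `θ¹(A v) = a θ^{1̄}(v)`. -/
def IsTanakaWebster (J : Endo) (θ : Form ℝ) (A : Endo) (W : S3 → ℝ) : Prop :=
  IsXiEndo A ∧ ∃ (θ1 φ : Form ℂ) (a : S3 → ℂ),
    SmoothS3 θ1 ∧ SmoothS3 φ ∧
    (∀ p, ∀ v ∈ xi p, θ1 p (J p v) = Complex.I * θ1 p v) ∧
    (∀ p, ∀ u ∈ tangent p, ∀ v ∈ tangent p,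
      ((extD θ p u v : ℝ) : ℂ) = Complex.I * wedgeC θ1 (conjForm θ1) p u v) ∧
    (∀ p, ∀ u ∈ tangent p, ∀ v ∈ tangent p,
      extD θ1 p u v = wedgeC θ1 φ p u v + a p * wedgeC (toC θ) (conjForm θ1) p u v) ∧
    (∀ p, ∀ v ∈ tangent p, φ p v + conjForm φ p v = 0) ∧
    (∀ p, ∀ u ∈ xi p, ∀ v ∈ xi p, extD φ p u v = (W p : ℂ) * wedgeC θ1 (conjForm θ1) p u v) ∧
    ∀ p, ∀ v ∈ xi p, θ1 p (A p v) = a p * conjForm θ1 p v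

/-- A solution, on the time set `I`, of the normalized torsion flow
`∂ₛ J = 2 A_{J,θ}`, `∂ₛ θ = -2 (W - W̄) θ`. -/
structure IsNormalizedTorsionFlow (I : Set ℝ) (J : ℝ → Endo) (θ : ℝ → Form ℝ) : Prop where
  smooth_J : ContMDiffOn (𝓘(ℝ, ℝ).prod (𝓡 3)) 𝓘(ℝ, C2 →L[ℝ] C2) ∞
    (fun x : ℝ × S3 => J x.1 x.2) (I ×ˢ Set.univ)
  smooth_form : ContMDiffOn (𝓘(ℝ, ℝ).prod (𝓡 3)) 𝓘(ℝ, C2 →L[ℝ] ℝ) ∞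
    (fun x : ℝ × S3 => θ x.1 x.2) (I ×ˢ Set.univ)
  pseudohermitian : ∀ s ∈ I, IsPseudohermitian (J s) (θ s)
  evolution : ∀ s ∈ I, ∃ (A : Endo) (W : S3 → ℝ), IsTanakaWebster (J s) (θ s) A W ∧
    ∀ p, HasDerivWithinAt (fun r => J r p) ((2 : ℝ) • A p) I s ∧
      HasDerivWithinAt (fun r => θ r p) ((-2 * (W p - mean (θ s) W)) • θ s p) I s

/-- A homogeneous solution: a solution consisting of homogeneous CR structures
`(J_{a_s b_s c_s}, b_s² ω¹)` for the standard coframe. -/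
def IsHomogeneousFlow (I : Set ℝ) (J : ℝ → Endo) (θ : ℝ → Form ℝ) : Prop :=
  IsNormalizedTorsionFlow I J θ ∧
    ∀ s ∈ I, ∃ a b c : ℝ, IsHomogeneousCR stdCoframe stdC a b c (J s) (θ s)

/-- `C^∞` convergence on `S³` as time tends to infinity: uniform convergence on `S³` of all
derivatives (of the extensions which are constant along rays). -/
def SmoothTendsto {V : Type} [NormedAddCommGroup V] [NormedSpace ℝ V]
    (f : ℝ → S3 → V) (g : S3 → V) : Prop :=
  ∀ m : ℕ, TendstoUniformlyOn (fun s x => iteratedFDeriv ℝ m (fun y : C2 => f s (retr y)) x)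
    (iteratedFDeriv ℝ m (fun y : C2 => g (retr y))) atTop (sphere (0 : C2) 1)

end

/-! Everything is computed in the orthonormal frame `ip, jp, kp` of the sphere. The forms
`stdCoframe i` are restrictions of linear maps on `ℂ²`, so their exterior derivatives follow from
the quaternion multiplication table. Rossi's structure is `diagJ c` with `c = (1-t)/(1+t)`, and
`stdJ = diagJ 1`.

Non-embeddability. For `c ^ 2 < 1` every CR function is even, so CR maps identify antipodal points
(`cr_function_even`). A CR function, extended constantly along rays, is killed by the derivation
`crOp c`. On linear functions this derivation squares to `-(1-c²)`, so it is diagonalizable there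
with eigenvalues `±il`, where `l = √(1-c²) > 0`. Products of eigenfunctions have eigenvalue `iln`
and parity `(-1)^n`, and their span is dense by Stone-Weierstrass. An odd solution `G` is orthogonal
to all of them: for even `n` by parity, for odd `n` because `crOp c` integrates to zero and `iln ≠
0`. Hence `G = 0` (`odd_crOp_eq_zero`).

Flow. On homogeneous structures the Webster curvature is constant, so the contact form does not
move. The complex structure is recorded by the point `m = (i-a)/c` of the upper half-plane. The
torsion (`IsHomogeneousCR.torsion_eq`) gives the Riccati equation `m' = i(1+m²)/b²`, and the Cayley
transform `τ = (m-i)/(m+i)` turns it into `τ' = -2τ/b²`. So the solution is Rossi's structure with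
parameter `t exp(-2s/b²)`, which yields existence, uniqueness and the limit `c → 1`. -/

noncomputable section

/-! ## The quaternionic frame -/

theorem inner_C2 (x y : C2) : inner ℝ x y =
    (x 0).re * (y 0).re + (x 0).im * (y 0).im + ((x 1).re * (y 1).re + (x 1).im * (y 1).im) := by
  simp [PiLp.inner_apply, Complex.inner, Fin.sum_univ_two]
  ring

theorem C2_ext {x y : C2} (h0 : (x 0).re = (y 0).re) (h1 : (x 0).im = (y 0).im)
    (h2 : (x 1).re = (y 1).re) (h3 : (x 1).im = (y 1).im) : x = y := by
  ext i
  fin_cases i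
  · exact Complex.ext h0 h1
  · exact Complex.ext h2 h3

theorem quat_zero_coord (x : C2) (i : Fin 2) : quat 0 x i = Complex.I * x i := by
  simp [quat, quatI]

theorem quat_one_coord_zero (x : C2) : quat 1 x 0 = -(starRingEnd ℂ) (x 1) := by
  simp [quat, quatJ]

theorem quat_one_coord_one (x : C2) : quat 1 x 1 = (starRingEnd ℂ) (x 0) := by
  simp [quat, quatJ]

theorem quat_two_coord_zero (x : C2) : quat 2 x 0 = -(Complex.I * (starRingEnd ℂ) (x 1)) := by
  simp [quat, quatI, quatJ]

theorem quat_two_coord_one (x : C2) : quat 2 x 1 = Complex.I * (starRingEnd ℂ) (x 0) := by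
  simp [quat, quatI, quatJ]

theorem quat_zero_apply (x : C2) : quat 0 x = Complex.I • x := by
  simp [quat, quatI]

theorem quat_sq (i : Fin 3) (x : C2) : quat i (quat i x) = -x := by
  fin_cases i <;> apply C2_ext <;>
    simp [quat_zero_coord, quat_one_coord_zero, quat_one_coord_one, quat_two_coord_zero,
      quat_two_coord_one]

theorem quat_zero_one (x : C2) : quat 0 (quat 1 x) = quat 2 x := by
  apply C2_ext <;>
    simp [quat_zero_coord, quat_one_coord_zero, quat_one_coord_one, quat_two_coord_zero,
      quat_two_coord_one]

theorem quat_one_zero (x : C2) : quat 1 (quat 0 x) = -quat 2 x := by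
  apply C2_ext <;>
    simp [quat_zero_coord, quat_one_coord_zero, quat_one_coord_one, quat_two_coord_zero,
      quat_two_coord_one]

theorem quat_one_two (x : C2) : quat 1 (quat 2 x) = quat 0 x := by
  apply C2_ext <;>
    simp [quat_zero_coord, quat_one_coord_zero, quat_one_coord_one, quat_two_coord_zero,
      quat_two_coord_one]

theorem quat_two_one (x : C2) : quat 2 (quat 1 x) = -quat 0 x := by
  apply C2_ext <;>
    simp [quat_zero_coord, quat_one_coord_zero, quat_one_coord_one, quat_two_coord_zero,
      quat_two_coord_one]

theorem quat_two_zero (x : C2) : quat 2 (quat 0 x) = quat 1 x := by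
  apply C2_ext <;>
    simp [quat_zero_coord, quat_one_coord_zero, quat_one_coord_one, quat_two_coord_zero,
      quat_two_coord_one]

theorem quat_zero_two (x : C2) : quat 0 (quat 2 x) = -quat 1 x := by
  apply C2_ext <;>
    simp [quat_zero_coord, quat_one_coord_zero, quat_one_coord_one, quat_two_coord_zero,
      quat_two_coord_one]

theorem inner_quat_left (i : Fin 3) (x y : C2) : inner ℝ (quat i x) y = -inner ℝ x (quat i y) := by
  fin_cases i <;>
    simp [inner_C2, quat_zero_coord, quat_one_coord_zero, quat_one_coord_one, quat_two_coord_zero,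
      quat_two_coord_one] <;> ring

theorem inner_quat_self (i : Fin 3) (x : C2) : inner ℝ x (quat i x) = 0 := by
  have h := inner_quat_left i x x
  rw [real_inner_comm] at h
  linarith

theorem inner_self_sphere (p : S3) : inner ℝ (p : C2) (p : C2) = 1 := by
  rw [real_inner_self_eq_norm_sq, norm_eq_of_mem_sphere, one_pow]

theorem inner_quat_quat (i j : Fin 3) (p : S3) :
    inner ℝ (quat i (p : C2)) (quat j (p : C2)) = if i = j then 1 else 0 := by
  rw [inner_quat_left]
  fin_cases i <;> fin_cases j <;>
    simp [quat_sq, quat_zero_one, quat_zero_two, quat_one_zero, quat_one_two, quat_two_zero,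
      quat_two_one, inner_quat_self]

theorem norm_quat (i : Fin 3) (x : C2) : ‖quat i x‖ = ‖x‖ := by
  have : ‖quat i x‖ ^ 2 = ‖x‖ ^ 2 := by
    rw [← real_inner_self_eq_norm_sq, ← real_inner_self_eq_norm_sq, inner_quat_left, quat_sq,
      inner_neg_right, neg_neg]
  exact (sq_eq_sq₀ (norm_nonneg _) (norm_nonneg _)).1 this

theorem stdCoframe_apply (i : Fin 3) (p : S3) (v : C2) :
    stdCoframe i p v = 2 * inner ℝ (quat i (p : C2)) v := by
  have h : HasFDerivAt (fun z : C2 => ‖z‖ ^ 2) (2 • innerSL ℝ (p : C2)) (p : C2) :=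
    (hasStrictFDerivAt_norm_sq (p : C2)).hasFDerivAt
  rw [inner_quat_left]
  simp [stdCoframe, h.fderiv]

theorem mem_tangent {p : S3} {v : C2} : v ∈ tangent p ↔ inner ℝ (p : C2) v = 0 := by
  simp [tangent]

theorem mem_xi {p : S3} {v : C2} : v ∈ xi p ↔ v ∈ tangent p ∧ stdCoframe 0 p v = 0 := by
  simp [xi]

theorem quat_mem_tangent (i : Fin 3) (p : S3) : quat i (p : C2) ∈ tangent p :=
  mem_tangent.2 (inner_quat_self i _)

/-- The 2 comes from differentiating `‖z‖²`. The frame dual to the coframe is therefore half of `ip,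
jp, kp`, which accounts for the halves in the expansions below. -/
theorem stdCoframe_quat (i j : Fin 3) (p : S3) :
    stdCoframe i p (quat j (p : C2)) = if i = j then 2 else 0 := by
  rw [stdCoframe_apply, inner_quat_quat]
  split_ifs <;> norm_num

theorem stdCoframe_self (i : Fin 3) (p : S3) : stdCoframe i p (p : C2) = 0 := by
  rw [stdCoframe_apply, real_inner_comm, inner_quat_self, mul_zero]

theorem xi_le_tangent {p : S3} {v : C2} (hv : v ∈ xi p) : v ∈ tangent p := (mem_xi.1 hv).1

theorem quat_one_mem_xi (p : S3) : quat 1 (p : C2) ∈ xi p :=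
  mem_xi.2 ⟨quat_mem_tangent _ _, by simp [stdCoframe_quat]⟩

theorem quat_two_mem_xi (p : S3) : quat 2 (p : C2) ∈ xi p :=
  mem_xi.2 ⟨quat_mem_tangent _ _, by simp [stdCoframe_quat]⟩

theorem sphere_coord (p : S3) : ((p : C2) 0).re ^ 2 + ((p : C2) 0).im ^ 2 +
    (((p : C2) 1).re ^ 2 + ((p : C2) 1).im ^ 2) = 1 := by
  have := inner_self_sphere p
  rw [inner_C2] at this
  linarith

/-- The expansion of a vector in the orthonormal frame `p, i p, j p, k p`. -/
theorem frame_expansion (p : S3) (v : C2) :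
    v = inner ℝ (p : C2) v • (p : C2) + ∑ i, (stdCoframe i p v / 2) • quat i (p : C2) := by
  have h := sphere_coord p
  simp only [stdCoframe_apply, Fin.sum_univ_three]
  apply C2_ext <;>
    simp [inner_C2, quat_zero_coord, quat_one_coord_zero, quat_one_coord_one, quat_two_coord_zero,
      quat_two_coord_one]
  · linear_combination -(v 0).re * h
  · linear_combination -(v 0).im * h
  · linear_combination -(v 1).re * h
  · linear_combination -(v 1).im * h

theorem tangent_expansion {p : S3} {v : C2} (hv : v ∈ tangent p) :
    v = (stdCoframe 0 p v / 2) • quat 0 (p : C2) + (stdCoframe 1 p v / 2) • quat 1 (p : C2) +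
      (stdCoframe 2 p v / 2) • quat 2 (p : C2) := by
  conv_lhs => rw [frame_expansion p v, mem_tangent.1 hv, zero_smul, zero_add]
  rw [Fin.sum_univ_three]

theorem xi_expansion {p : S3} {v : C2} (hv : v ∈ xi p) :
    v = (stdCoframe 1 p v / 2) • quat 1 (p : C2) + (stdCoframe 2 p v / 2) • quat 2 (p : C2) := by
  conv_lhs => rw [tangent_expansion (xi_le_tangent hv), (mem_xi.1 hv).2]
  simp

/-! ## The retraction -/

theorem coe_retr {x : C2} (hx : x ≠ 0) : (retr x : C2) = (‖x‖⁻¹ : ℝ) • x := by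
  simp [retr, hx]

theorem retr_coe (p : S3) : retr (p : C2) = p := by
  have hp : (p : C2) ≠ 0 := ne_zero_of_mem_unit_sphere p
  apply Subtype.ext
  rw [coe_retr hp, norm_eq_of_mem_sphere, inv_one, one_smul]

theorem contDiffAt_coe_retr {x : C2} (hx : x ≠ 0) :
    ContDiffAt ℝ ∞ (fun y => (retr y : C2)) x := by
  have h : ContDiffAt ℝ ∞ (fun y : C2 => (‖y‖⁻¹ : ℝ) • y) x :=
    ((contDiffAt_norm ℝ hx).inv (norm_ne_zero_iff.2 hx)).smul contDiffAt_id
  refine h.congr_of_eventuallyEq ?_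
  filter_upwards [isOpen_ne.mem_nhds hx] with y hy
  exact coe_retr hy

theorem contMDiffAt_retr {x : C2} (hx : x ≠ 0) : ContMDiffAt 𝓘(ℝ, C2) (𝓡 3) ∞ retr x := by
  -- On the open submanifold of nonzero vectors the retraction is smooth everywhere, so its codomain
  -- can be restricted to the sphere globally.
  let U : TopologicalSpace.Opens C2 := ⟨{y | y ≠ 0}, isOpen_ne⟩
  have h1 : ContMDiff 𝓘(ℝ, C2) 𝓘(ℝ, C2) ∞ (fun y : U => (retr (y : C2) : C2)) := by
    intro y
    rw [contMDiffAt_subtype_iff (f := fun y : C2 => (retr y : C2))]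
    exact (contDiffAt_coe_retr y.2).contMDiffAt
  have h2 := (h1.codRestrict_sphere (n := 3) fun y => (retr (y : C2)).2) (⟨x, hx⟩ : U)
  exact (contMDiffAt_subtype_iff (U := U) (f := retr) (x := ⟨x, hx⟩)).1 h2

/-- The norm is stationary in tangential directions, so only the factor `x` of `‖x‖⁻¹ x`
contributes. -/
theorem fderiv_coe_retr (p : S3) {v : C2} (hv : v ∈ tangent p) :
    fderiv ℝ (fun y => (retr y : C2)) (p : C2) v = v := by
  have hp : (p : C2) ≠ 0 := ne_zero_of_mem_unit_sphere p
  have e : (fun y => (retr y : C2)) =ᶠ[𝓝 (p : C2)] fun y : C2 => (‖y‖⁻¹ : ℝ) • y := by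
    filter_upwards [isOpen_ne.mem_nhds hp] with y hy
    exact coe_retr hy
  have hn : ‖(p : C2)‖ = 1 := norm_eq_of_mem_sphere p
  have hd : DifferentiableAt ℝ (fun y : C2 => ‖y‖) (p : C2) :=
    (contDiffAt_norm ℝ hp (n := 1)).differentiableAt one_ne_zero
  have hnv : fderiv ℝ (fun y : C2 => ‖y‖) (p : C2) v = 0 := by
    have h1 : fderiv ℝ (fun y : C2 => ‖y‖ ^ 2) (p : C2) v = 0 := by
      rw [(hasStrictFDerivAt_norm_sq (p : C2)).hasFDerivAt.fderiv]
      simp [mem_tangent.1 hv]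
    rw [(hd.hasFDerivAt.pow 2).fderiv] at h1
    simpa [hn] using h1
  have hi := ((hasDerivAt_inv (norm_ne_zero_iff.2 hp)).comp_hasFDerivAt (p : C2)
    hd.hasFDerivAt).smul (hasFDerivAt_id (p : C2))
  rw [e.fderiv_eq]
  erw [hi.fderiv]
  simp [hn, hnv]

section Smooth

variable {V : Type} [NormedAddCommGroup V] [NormedSpace ℝ V]

theorem SmoothS3.contDiffAt_retr {f : S3 → V} (hf : SmoothS3 f) {x : C2} (hx : x ≠ 0) :
    ContDiffAt ℝ ∞ (fun y => f (retr y)) x :=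
  contMDiffAt_iff_contDiffAt.1 ((hf (retr x)).comp x (contMDiffAt_retr hx))

theorem SmoothS3.differentiableAt_retr {f : S3 → V} (hf : SmoothS3 f) (p : S3) :
    DifferentiableAt ℝ (fun y => f (retr y)) (p : C2) :=
  (hf.contDiffAt_retr (ne_zero_of_mem_unit_sphere p)).differentiableAt (by simp)

theorem smoothS3_restrict {g : C2 → V} (hg : ContDiff ℝ ∞ g) : SmoothS3 (fun p : S3 => g p) :=
  hg.contMDiff.comp contMDiff_coe_sphere

theorem fnD_restrict {g : C2 → V} {p : S3} (hg : DifferentiableAt ℝ g (p : C2)) {v : C2}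
    (hv : v ∈ tangent p) : fnD (fun q : S3 => g q) p v = fderiv ℝ g (p : C2) v := by
  have hp : (p : C2) ≠ 0 := ne_zero_of_mem_unit_sphere p
  have h1 : DifferentiableAt ℝ (fun y => (retr y : C2)) (p : C2) :=
    (contDiffAt_coe_retr hp).differentiableAt (by simp)
  have h2 : DifferentiableAt ℝ g (retr (p : C2) : C2) := by rwa [retr_coe]
  unfold fnD
  rw [fderiv_fun_comp (p : C2) h2 h1, retr_coe, ContinuousLinearMap.comp_apply, fderiv_coe_retr p hv]

end Smooth

/-! ## The exterior derivative -/

section Forms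

variable {F : Type} [NormedAddCommGroup F] [NormedSpace ℝ F]

theorem fderiv_coe_retr_mem_tangent {x : C2} (hx : x ≠ 0) (v : C2) :
    fderiv ℝ (fun y => (retr y : C2)) x v ∈ tangent (retr x) := by
  have hd : DifferentiableAt ℝ (fun y => (retr y : C2)) x :=
    (contDiffAt_coe_retr hx).differentiableAt (by simp)
  have h1 : (fun y => inner ℝ (retr y : C2) (retr y : C2)) = fun _ => (1 : ℝ) := by
    funext y
    exact inner_self_sphere _
  have h2 := fderiv_inner_apply ℝ hd hd v
  rw [h1, real_inner_comm (retr x : C2)] at h2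
  simp only [fderiv_fun_const, Pi.zero_apply, zero_apply] at h2
  refine mem_tangent.2 ?_
  linarith

/-- The derivative of the retraction has tangential values, so the pull-back only sees the form on
tangent vectors. -/
theorem extD_congr {η ζ : Form F} (h : ∀ p, ∀ v ∈ tangent p, η p v = ζ p v) (p : S3) :
    extD η p = extD ζ p := by
  have e : pull η =ᶠ[𝓝 (p : C2)] pull ζ := by
    filter_upwards [isOpen_ne.mem_nhds (ne_zero_of_mem_unit_sphere p)] with x hx
    ext v
    exact h _ _ (fderiv_coe_retr_mem_tangent hx v)
  funext u v
  simp only [extD, e.fderiv_eq]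

/-- The product rule leaves a term with the second derivative of the retraction; it is symmetric and
cancels on antisymmetrization. -/
theorem extD_eq_fnD {η : Form F} {p : S3}
    (hη : DifferentiableAt ℝ (fun y => η (retr y)) (p : C2)) {u v : C2}
    (hu : u ∈ tangent p) (hv : v ∈ tangent p) :
    extD η p u v = fnD η p u v - fnD η p v u := by
  have hp : (p : C2) ≠ 0 := ne_zero_of_mem_unit_sphere p
  have hr := contDiffAt_coe_retr hp
  have hd : DifferentiableAt ℝ (fderiv ℝ (fun y => (retr y : C2))) (p : C2) :=
    (hr.fderiv_right (m := 1) (by norm_cast)).differentiableAt one_ne_zero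
  have hs : IsSymmSndFDerivAt ℝ (fun y => (retr y : C2)) (p : C2) :=
    hr.isSymmSndFDerivAt (by simpa using WithTop.coe_le_coe.2 (le_top : (2 : ℕ∞) ≤ ⊤))
  have key : ∀ a b : C2, b ∈ tangent p → fderiv ℝ (pull η) (p : C2) a b =
      fnD η p a b + η p (fderiv ℝ (fderiv ℝ (fun y => (retr y : C2))) (p : C2) a b) := by
    intro a b hb
    have := (hη.hasFDerivAt.clm_comp hd.hasFDerivAt).fderiv
    unfold pull
    rw [this]
    simp [fnD, fderiv_coe_retr p hb, retr_coe, add_comm]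
  rw [extD, key u v hv, key v u hu, hs.eq u v]
  abel

theorem extD_linear (Λ : C2 →L[ℝ] C2 →L[ℝ] F) {p : S3} {u v : C2}
    (hu : u ∈ tangent p) (hv : v ∈ tangent p) :
    extD (fun q : S3 => Λ q) p u v = Λ u v - Λ v u := by
  have h := (smoothS3_restrict Λ.contDiff).differentiableAt_retr p
  rw [extD_eq_fnD h hu hv, fnD_restrict Λ.differentiableAt hu, fnD_restrict Λ.differentiableAt hv,
    Λ.fderiv]

end Forms

/-- The standard coframe as a linear map on `ℂ²`. -/
def coframeL (i : Fin 3) : C2 →L[ℝ] C2 →L[ℝ] ℝ := LinearMap.toContinuousLinearMap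
  { toFun := fun x => (2 : ℝ) • innerSL ℝ (quat i x)
    map_add' := fun x y => by simp
    map_smul' := fun r x => by
      ext v
      simp
      ring }

theorem coframeL_apply (i : Fin 3) (x v : C2) : coframeL i x v = 2 * inner ℝ (quat i x) v := by
  simp [coframeL]

theorem stdCoframe_eq (i : Fin 3) : stdCoframe i = fun p : S3 => coframeL i p := by
  funext p
  ext v
  rw [stdCoframe_apply, coframeL_apply]

theorem smoothS3_stdCoframe (i : Fin 3) : SmoothS3 (stdCoframe i) := by
  rw [stdCoframe_eq]
  exact smoothS3_restrict (coframeL i).contDiff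

theorem coframeL_sub (i : Fin 3) (u v : C2) :
    coframeL i u v - coframeL i v u = 4 * inner ℝ (quat i u) v := by
  rw [coframeL_apply, coframeL_apply, inner_quat_left i v u, real_inner_comm v]
  ring

/-! ## Structure equations -/

theorem extD_stdCoframe (i : Fin 3) {p : S3} {u v : C2} (hu : u ∈ tangent p)
    (hv : v ∈ tangent p) : extD (stdCoframe i) p u v = 4 * inner ℝ (quat i u) v := by
  rw [stdCoframe_eq, extD_linear (coframeL i) hu hv, coframeL_sub]

/-- Expanding `u` in the frame turns `quat i u` into products of quaternion units applied to `p`,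
whose inner products with `v` are again coframe values. -/
theorem extD_stdCoframe_wedge (i : Fin 3) {p : S3} {u v : C2} (hu : u ∈ tangent p)
    (hv : v ∈ tangent p) : extD (stdCoframe i) p u v =
      ![wedgeR (stdCoframe 1) (stdCoframe 2) p u v, -wedgeR (stdCoframe 0) (stdCoframe 2) p u v,
        wedgeR (stdCoframe 0) (stdCoframe 1) p u v] i := by
  rw [extD_stdCoframe i hu hv]
  generalize ha : stdCoframe 0 p u = a
  generalize hb : stdCoframe 1 p u = b
  generalize hc : stdCoframe 2 p u = c
  have h := tangent_expansion hu
  rw [ha, hb, hc] at h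
  simp only [wedgeR, ha, hb, hc]
  rw [h]
  fin_cases i <;>
    simp only [stdCoframe_apply, map_add, map_smul, quat_sq, quat_zero_one,
      quat_zero_two, quat_one_zero, quat_one_two, quat_two_zero, quat_two_one, inner_add_left,
      real_inner_smul_left, inner_neg_left, mem_tangent.1 hv, Fin.zero_eta, Fin.mk_one,
      Fin.reduceFinMk, Matrix.cons_val_zero, Matrix.cons_val_one, Matrix.cons_val] <;> ring

theorem isNormalized_stdC : IsNormalized stdC := by
  simp [IsNormalized, stdC]

theorem extD_stdCoframe_stdC (i : Fin 3) {p : S3} {u v : C2} (hu : u ∈ tangent p)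
    (hv : v ∈ tangent p) : extD (stdCoframe i) p u v = ∑ j, ∑ k,
      if j < k then stdC i j k * wedgeR (stdCoframe j) (stdCoframe k) p u v else 0 := by
  rw [extD_stdCoframe_wedge i hu hv]
  fin_cases i <;> simp [Fin.sum_univ_three, stdC]

/-! ## Multiples of the standard contact form -/

theorem smul_stdCoframe_eq (r : ℝ) :
    r • stdCoframe 0 = fun p : S3 => (r • coframeL 0) (p : C2) := by
  rw [stdCoframe_eq]
  rfl

theorem smoothS3_smul_stdCoframe (r : ℝ) : SmoothS3 (r • stdCoframe 0) := by
  rw [smul_stdCoframe_eq]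
  exact smoothS3_restrict (r • coframeL 0).contDiff

theorem extD_smul_stdCoframe (r : ℝ) {p : S3} {u v : C2} (hu : u ∈ tangent p)
    (hv : v ∈ tangent p) : extD (r • stdCoframe 0) p u v =
      r * wedgeR (stdCoframe 1) (stdCoframe 2) p u v := by
  have h0 : extD (stdCoframe 0) p u v = wedgeR (stdCoframe 1) (stdCoframe 2) p u v :=
    extD_stdCoframe_wedge 0 hu hv
  rw [← h0, extD_stdCoframe 0 hu hv, smul_stdCoframe_eq, extD_linear _ hu hv]
  have := coframeL_sub 0 u v
  simp only [smul_apply, smul_eq_mul]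
  linear_combination r * this

theorem contactDensity_smul_stdCoframe (r : ℝ) (p : S3) :
    contactDensity (r • stdCoframe 0) p = 8 * r ^ 2 := by
  simp only [contactDensity, extD_smul_stdCoframe r (quat_mem_tangent _ p) (quat_mem_tangent _ p),
    wedgeR, Pi.smul_apply, smul_apply, smul_eq_mul, stdCoframe_quat]
  simp
  ring

theorem isContact_smul_stdCoframe {r : ℝ} (hr : r ≠ 0) : IsContact (r • stdCoframe 0) :=
  ⟨smoothS3_smul_stdCoframe r, fun p => by
    rw [contactDensity_smul_stdCoframe]
    positivity⟩

theorem isHomogeneousContact_stdCoframe :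
    IsHomogeneousContact stdCoframe stdC (stdCoframe 0) where
  smooth := smoothS3_stdCoframe
  basis p v hv h := by
    rw [tangent_expansion hv, h, h, h]
    simp
  structure_eq i p u hu v hv := extD_stdCoframe_stdC i hu hv
  combination := ⟨![1, 0, 0], fun p v _ => by simp [Fin.sum_univ_three]⟩
  contact := by
    have := isContact_smul_stdCoframe (one_ne_zero (α := ℝ))
    rwa [one_smul] at this

theorem form_ext {F : Type} [NormedAddCommGroup F] [NormedSpace ℝ F] {η ζ : Form F}
    (h : ∀ p, ∀ v ∈ tangent p, η p v = ζ p v) (hn : ∀ p : S3, η p p = ζ p p) : η = ζ := by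
  funext p
  ext v
  rw [frame_expansion p v]
  simp only [map_add, map_smul, map_sum, hn]
  congr 1
  exact Finset.sum_congr rfl fun i _ => by rw [h p _ (quat_mem_tangent i p)]

/-! ## Endomorphism fields of the contact structure -/

/-- The endomorphism field `X₂ ↦ α X₃`, `X₃ ↦ β X₂` of `ξ`. -/
def xiEndo (α β : ℝ) : Endo := fun p =>
  α • (innerSL ℝ (quat 1 (p : C2))).smulRight (quat 2 (p : C2)) +
    β • (innerSL ℝ (quat 2 (p : C2))).smulRight (quat 1 (p : C2))

theorem xiEndo_apply (α β : ℝ) (p : S3) (v : C2) : xiEndo α β p v =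
    (α * (stdCoframe 1 p v / 2)) • quat 2 (p : C2) +
      (β * (stdCoframe 2 p v / 2)) • quat 1 (p : C2) := by
  simp [xiEndo, stdCoframe_apply, smul_smul]

theorem contDiff_xiEndo (α β : ℝ) : ContDiff ℝ ∞ fun x : C2 =>
    α • (innerSL ℝ (quat 1 x)).smulRight (quat 2 x) +
    β • (innerSL ℝ (quat 2 x)).smulRight (quat 1 x) := by
  have h (i : Fin 3) : ContDiff ℝ ∞ fun x : C2 => innerSL ℝ (quat i x) :=
    (innerSL ℝ).contDiff.comp (quat i).contDiff
  exact (((h 1).smulRight (quat 2).contDiff).const_smul α).add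
    (((h 2).smulRight (quat 1).contDiff).const_smul β)

theorem stdCoframe_xiEndo (i : Fin 3) (α β : ℝ) (p : S3) (v : C2) :
    stdCoframe i p (xiEndo α β p v) =
      ![0, β * stdCoframe 2 p v, α * stdCoframe 1 p v] i := by
  rw [xiEndo_apply, map_add, map_smul, map_smul, stdCoframe_quat, stdCoframe_quat]
  fin_cases i <;> simp <;> ring

theorem xiEndo_mem_xi (α β : ℝ) (p : S3) (v : C2) : xiEndo α β p v ∈ xi p := by
  rw [xiEndo_apply]
  exact add_mem (Submodule.smul_mem _ _ (quat_two_mem_xi p))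
    (Submodule.smul_mem _ _ (quat_one_mem_xi p))

theorem isXiEndo_xiEndo (α β : ℝ) : IsXiEndo (xiEndo α β) where
  smooth := smoothS3_restrict (contDiff_xiEndo α β)
  maps_xi p v _ := xiEndo_mem_xi α β p v
  normal p := by simp [xiEndo_apply, stdCoframe_self, stdCoframe_quat]

/-- The normalization fixes the field on `p` and `ip`, and on `ξ` its values are determined by their
two components. -/
theorem IsXiEndo.ext {J J' : Endo} (hJ : IsXiEndo J) (hJ' : IsXiEndo J')
    (h1 : ∀ p, ∀ v ∈ xi p, stdCoframe 1 p (J p v) = stdCoframe 1 p (J' p v))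
    (h2 : ∀ p, ∀ v ∈ xi p, stdCoframe 2 p (J p v) = stdCoframe 2 p (J' p v)) : J = J' := by
  have h : ∀ p, ∀ v ∈ xi p, J p v = J' p v := fun p v hv => by
    rw [xi_expansion (hJ.maps_xi p v hv), xi_expansion (hJ'.maps_xi p v hv), h1 p v hv, h2 p v hv]
  funext p
  ext1 v
  rw [frame_expansion p v, Fin.sum_univ_three]
  simp only [map_add, map_smul, (hJ.normal p).1, (hJ.normal p).2, (hJ'.normal p).1,
    (hJ'.normal p).2, h p _ (quat_one_mem_xi p), h p _ (quat_two_mem_xi p)]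

/-- The complex structure `X₂ ↦ c X₃`, `X₃ ↦ -c⁻¹ X₂` of `ξ`. -/
def diagJ (c : ℝ) : Endo := xiEndo c (-c⁻¹)

theorem isCR_diagJ {c : ℝ} (hc : c ≠ 0) : IsCR (diagJ c) where
  toIsXiEndo := isXiEndo_xiEndo _ _
  sq p v hv := by
    conv_rhs => rw [xi_expansion hv]
    rw [diagJ, xiEndo_apply, stdCoframe_xiEndo, stdCoframe_xiEndo]
    simp only [Matrix.cons_val_one, Matrix.cons_val, Matrix.cons_val_zero]
    rw [neg_add, ← neg_smul, ← neg_smul, add_comm]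
    congr 2 <;> field_simp

theorem isPseudohermitian_diagJ {c r : ℝ} (hc : 0 < c) (hr : 0 < r) :
    IsPseudohermitian (diagJ c) (r • stdCoframe 0) where
  cr := isCR_diagJ hc.ne'
  contact := isContact_smul_stdCoframe hr.ne'
  normal p := by simp [stdCoframe_self]
  ker_eq p v hv := by
    rw [mem_xi]
    simp [hv, hr.ne']
  pos p v hv hv0 := by
    have hJ := xi_le_tangent (xiEndo_mem_xi c (-c⁻¹) p v)
    rw [diagJ, extD_smul_stdCoframe r (xi_le_tangent hv) hJ, wedgeR, stdCoframe_xiEndo,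
      stdCoframe_xiEndo]
    simp only [Matrix.cons_val_one, Matrix.cons_val, Matrix.cons_val_zero]
    have h : stdCoframe 1 p v ≠ 0 ∨ stdCoframe 2 p v ≠ 0 := by
      by_contra! h
      apply hv0
      rw [xi_expansion hv, h.1, h.2]
      simp
    have e : r * (stdCoframe 1 p v * (c * stdCoframe 1 p v) -
        -c⁻¹ * stdCoframe 2 p v * stdCoframe 2 p v) =
        r * (c * stdCoframe 1 p v ^ 2 + c⁻¹ * stdCoframe 2 p v ^ 2) := by ring
    rw [e]
    rcases h with h | h <;> positivity

theorem isHomogeneousCR_diagJ {b c : ℝ} (hb : 0 < b) (hc : 0 < c) :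
    IsHomogeneousCR stdCoframe stdC 0 b c (diagJ c) (b ^ 2 • stdCoframe 0) where
  homogeneous := isHomogeneousContact_stdCoframe
  normalized := isNormalized_stdC
  b_pos := hb
  c_pos := hc
  form_eq p v _ := by simp
  pseudohermitian := isPseudohermitian_diagJ hc (by positivity)
  coeff_two p v _ := by
    rw [diagJ, stdCoframe_xiEndo]
    simp
  coeff_three p v _ := by
    rw [diagJ, stdCoframe_xiEndo]
    simp

/-! ## The standard structure -/

/-- `stdJ` is `i` times the complex orthogonal projection along `p`. Since `ξ_p` is the complex
orthogonal complement of `p`, it acts there as `quat 0`, and `ij = k` gives `c = 1`. -/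
theorem stdJ_eq : stdJ = diagJ 1 := by
  have hin : ∀ p v : C2, inner ℂ p v =
      (starRingEnd ℂ) (p 0) * v 0 + (starRingEnd ℂ) (p 1) * v 1 := fun p v => by
    simp [PiLp.inner_apply, Fin.sum_univ_two, mul_comm]
  have hin1 (p : S3) : inner ℂ (p : C2) (p : C2) = 1 := by
    rw [inner_self_eq_norm_sq_to_K, norm_eq_of_mem_sphere]
    simp
  have h0 (p : S3) (v : C2) : stdJ p v = Complex.I • (v - inner ℂ (p : C2) v • (p : C2)) := by
    simp [stdJ]
  have h1 (p : S3) : ∀ v ∈ xi p, stdJ p v = quat 0 v := fun v hv => by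
    have h2 : inner ℂ (p : C2) v = 0 := by
      have ha := mem_tangent.1 (xi_le_tangent hv)
      have hb := (mem_xi.1 hv).2
      rw [stdCoframe_apply] at hb
      rw [inner_C2] at ha hb
      simp [quat_zero_coord] at hb
      rw [hin]
      apply Complex.ext <;> simp <;> linarith
    rw [h0, h2, zero_smul, sub_zero, quat_zero_apply]
  funext p
  ext1 v
  have hp : stdJ p p = 0 := by rw [h0, hin1, one_smul, sub_self, smul_zero]
  have hip : stdJ p (quat 0 (p : C2)) = 0 := by
    rw [h0, quat_zero_apply, inner_smul_right, hin1, mul_one, sub_self, smul_zero]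
  have hn := (isXiEndo_xiEndo 1 (-1⁻¹)).normal p
  rw [frame_expansion p v, Fin.sum_univ_three]
  simp only [map_add, map_smul, hp, hip, diagJ, hn.1, hn.2, h1 p _ (quat_one_mem_xi p),
    h1 p _ (quat_two_mem_xi p), quat_zero_one, quat_zero_two, xiEndo_apply, stdCoframe_quat]
  simp

theorem isEmbeddable_stdJ : IsEmbeddable stdJ := by
  have hd (p : S3) {v : C2} (hv : v ∈ tangent p) : fnD (fun q : S3 => (q : C2)) p v = v := by
    have := fnD_restrict (g := id) (p := p) differentiableAt_id hv
    simpa using this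
  refine ⟨2, fun p => (p : C2), smoothS3_restrict contDiff_id, IsEmbedding.subtypeVal,
    fun p v hv h => by rwa [hd p hv] at h, fun p v hv => ?_⟩
  have hJ := xi_le_tangent (xiEndo_mem_xi 1 (-1⁻¹) p v)
  rw [stdJ_eq, hd p (xi_le_tangent hv), diagJ, hd p hJ, xiEndo_apply, ← quat_zero_apply]
  conv_rhs => rw [xi_expansion hv]
  rw [map_add, map_smul, map_smul, quat_zero_one, quat_zero_two]
  norm_num

/-! ## Rossi's structures -/

theorem rossiTheta1_apply (t : ℝ) (p : S3) (v : C2) : rossiTheta1 t p v =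
    ((Real.sqrt (1 - t ^ 2))⁻¹ * (Real.sqrt 2)⁻¹ : ℝ) *
      ((1 - t : ℝ) * stdCoframe 1 p v + Complex.I * ((1 + t : ℝ) * stdCoframe 2 p v)) := by
  simp [rossiTheta1, stdTheta1, conjForm, toC]
  ring

/-- Up to a nonzero real factor the form is `(1-t)ω² + i(1+t)ω³`; real and imaginary parts give the
two equations. -/
theorem rossi_type_iff {t : ℝ} (ht : |t| < 1) (p : S3) (v w : C2) :
    rossiTheta1 t p w = Complex.I * rossiTheta1 t p v ↔
      stdCoframe 1 p w = -((1 - t) / (1 + t))⁻¹ * stdCoframe 2 p v ∧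
      stdCoframe 2 p w = (1 - t) / (1 + t) * stdCoframe 1 p v := by
  obtain ⟨h1, h2⟩ := abs_lt.1 ht
  have ha : 0 < 1 + t := by linarith
  have hb : 0 < 1 - t := by linarith
  have hs : 0 < 1 - t ^ 2 := by nlinarith
  have hk : (((Real.sqrt (1 - t ^ 2))⁻¹ * (Real.sqrt 2)⁻¹ : ℝ) : ℂ) ≠ 0 := by
    have : 0 < Real.sqrt (1 - t ^ 2) := Real.sqrt_pos.2 hs
    have h2 : 0 < Real.sqrt 2 := by positivity
    exact_mod_cast (by positivity : (0 : ℝ) < _).ne'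
  rw [rossiTheta1_apply, rossiTheta1_apply]
  generalize (((Real.sqrt (1 - t ^ 2))⁻¹ * (Real.sqrt 2)⁻¹ : ℝ) : ℂ) = k at hk ⊢
  rw [mul_left_comm Complex.I k, mul_right_inj' hk, Complex.ext_iff]
  simp only [Complex.add_re, Complex.mul_re, Complex.ofReal_re, Complex.ofReal_im, Complex.I_re,
    Complex.I_im, Complex.add_im, Complex.mul_im]
  constructor
  · rintro ⟨h3, h4⟩
    constructor
    · field_simp
      linarith
    · field_simp
      linarith
  · rintro ⟨h3, h4⟩
    rw [h3, h4]
    constructor <;> field_simp <;> ring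

theorem isRossi_diagJ {t : ℝ} (ht : |t| < 1) : IsRossi t (diagJ ((1 - t) / (1 + t))) := by
  obtain ⟨h1, h2⟩ := abs_lt.1 ht
  have ha : 0 < 1 + t := by linarith
  have hb : 0 < 1 - t := by linarith
  refine ⟨isCR_diagJ (div_pos hb ha).ne', fun p v _ => (rossi_type_iff ht p v _).2 ?_⟩
  simp [diagJ, stdCoframe_xiEndo]

theorem IsRossi.eq_diagJ {t : ℝ} (ht : |t| < 1) {J : Endo} (hJ : IsRossi t J) :
    J = diagJ ((1 - t) / (1 + t)) := by
  refine hJ.1.toIsXiEndo.ext (isRossi_diagJ ht).1.toIsXiEndo ?_ ?_ <;> intro p v hv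
  · rw [((rossi_type_iff ht p v _).1 (hJ.2 p v hv)).1,
      ((rossi_type_iff ht p v _).1 ((isRossi_diagJ ht).2 p v hv)).1]
  · rw [((rossi_type_iff ht p v _).1 (hJ.2 p v hv)).2,
      ((rossi_type_iff ht p v _).1 ((isRossi_diagJ ht).2 p v hv)).2]

/-! ## Complex forms with constant coefficients -/

/-- The complex 1-form with constant coefficients `α` in the standard coframe. -/
def coframeComb (α : Fin 3 → ℂ) : Form ℂ := fun p => ∑ i, α i • toC (stdCoframe i) p

/-- `coframeComb` as a linear map on `ℂ²`. -/
def coframeCombL (α : Fin 3 → ℂ) : C2 →L[ℝ] C2 →L[ℝ] ℂ :=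
  ∑ i, α i • (ContinuousLinearMap.compL ℝ C2 ℝ ℂ Complex.ofRealCLM).comp (coframeL i)

theorem coframeComb_eq (α : Fin 3 → ℂ) : coframeComb α = fun p : S3 => coframeCombL α p := by
  funext p
  simp [coframeComb, coframeCombL, toC, stdCoframe_eq]

theorem coframeComb_apply (α : Fin 3 → ℂ) (p : S3) (v : C2) :
    coframeComb α p v = α 0 * stdCoframe 0 p v + α 1 * stdCoframe 1 p v +
      α 2 * stdCoframe 2 p v := by
  simp [coframeComb, toC, Fin.sum_univ_three]

theorem smoothS3_coframeComb (α : Fin 3 → ℂ) : SmoothS3 (coframeComb α) := by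
  rw [coframeComb_eq]
  exact smoothS3_restrict (coframeCombL α).contDiff

theorem extD_coframeComb (α : Fin 3 → ℂ) {p : S3} {u v : C2} (hu : u ∈ tangent p)
    (hv : v ∈ tangent p) : extD (coframeComb α) p u v =
      α 0 * (wedgeR (stdCoframe 1) (stdCoframe 2) p u v : ℝ) -
      α 1 * (wedgeR (stdCoframe 0) (stdCoframe 2) p u v : ℝ) +
      α 2 * (wedgeR (stdCoframe 0) (stdCoframe 1) p u v : ℝ) := by
  have h (i : Fin 3) := (coframeL_sub i u v).trans
    ((extD_stdCoframe i hu hv).symm.trans (extD_stdCoframe_wedge i hu hv))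
  have h0 := congrArg (Complex.ofReal) (h 0)
  have h1 := congrArg (Complex.ofReal) (h 1)
  have h2 := congrArg (Complex.ofReal) (h 2)
  simp only [Complex.ofReal_sub, Matrix.cons_val_zero, Matrix.cons_val_one, Matrix.cons_val,
    Complex.ofReal_neg] at h0 h1 h2
  rw [coframeComb_eq, extD_linear _ hu hv]
  simp [coframeCombL, Fin.sum_univ_three]
  linear_combination α 0 * h0 + α 1 * h1 + α 2 * h2

/-! ## The Tanaka-Webster connection of the diagonal structures -/

theorem isTanakaWebster_diagJ {b c : ℝ} (hb : 0 < b) (hc : 0 < c) :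
    IsTanakaWebster (diagJ c) (b ^ 2 • stdCoframe 0)
      (xiEndo ((1 - c ^ 2) / (2 * b ^ 2)) ((1 - c ^ 2) / (2 * b ^ 2 * c ^ 2)))
      (fun _ => (c + c⁻¹) / (2 * b ^ 2)) := by
  -- The form `x(ω² + (i/c)ω³)` is of type `(1,0)`, and `i θ¹∧θ^{1̄} = (2x²/c) ω²∧ω³` must equal `b²
  -- ω²∧ω³`, hence `x² = b²c/2`.
  set x : ℝ := b * Real.sqrt (c / 2) with hx
  have hx2 : (x : ℂ) ^ 2 = b ^ 2 * c / 2 := by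
    have : x ^ 2 = b ^ 2 * c / 2 := by
      rw [hx, mul_pow, Real.sq_sqrt (by positivity)]
      ring
    exact_mod_cast this
  have hb' : (b : ℂ) ≠ 0 := by exact_mod_cast hb.ne'
  have hc' : (c : ℂ) ≠ 0 := by exact_mod_cast hc.ne'
  have hI : Complex.I ^ 2 = -1 := Complex.I_sq
  have hconj : (starRingEnd ℂ) 2 = 2 := map_ofNat _ 2
  refine ⟨isXiEndo_xiEndo _ _, coframeComb ![0, x, x * (Complex.I / c)],
    coframeComb ![-(Complex.I * (c + (c : ℂ)⁻¹) / 2), 0, 0],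
    fun _ => -(Complex.I * (c - (c : ℂ)⁻¹) / (2 * b ^ 2)), smoothS3_coframeComb _,
    smoothS3_coframeComb _, ?_, ?_, ?_, ?_, ?_, ?_⟩
  · intro p v hv
    simp only [coframeComb_apply, diagJ, stdCoframe_xiEndo, Matrix.cons_val_zero,
      Matrix.cons_val_one, Matrix.cons_val]
    push_cast
    field_simp
    linear_combination (-(x : ℂ) * (stdCoframe 2 p v : ℂ)) * hI
  · intro p u hu v hv
    rw [extD_smul_stdCoframe _ hu hv]
    simp only [wedgeC, wedgeR, conjForm, coframeComb_apply, ContinuousLinearMap.comp_apply,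
      Matrix.cons_val_zero, Matrix.cons_val_one, Matrix.cons_val]
    simp
    field_simp
    linear_combination 2 * c * x ^ 2 * ((stdCoframe 1 p u : ℂ) * stdCoframe 2 p v -
        (stdCoframe 1 p v : ℂ) * stdCoframe 2 p u) * hI -
      2 * c * ((stdCoframe 1 p u : ℂ) * stdCoframe 2 p v -
        (stdCoframe 1 p v : ℂ) * stdCoframe 2 p u) * hx2
  · intro p u hu v hv
    rw [extD_coframeComb _ hu hv]
    simp only [wedgeC, wedgeR, conjForm, coframeComb_apply, ContinuousLinearMap.comp_apply,
      Matrix.cons_val_zero, Matrix.cons_val_one, Matrix.cons_val, toC]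
    simp
    field_simp
    linear_combination -2 * x * c ^ 2 * ((stdCoframe 0 p u : ℂ) * stdCoframe 2 p v -
        (stdCoframe 0 p v : ℂ) * stdCoframe 2 p u) * hI
  · intro p v hv
    simp only [conjForm, coframeComb_apply, ContinuousLinearMap.comp_apply,
      Matrix.cons_val_zero, Matrix.cons_val_one, Matrix.cons_val]
    simp [hconj]
    ring
  · intro p u hu v hv
    rw [extD_coframeComb _ (xi_le_tangent hu) (xi_le_tangent hv)]
    simp only [wedgeC, wedgeR, conjForm, coframeComb_apply, ContinuousLinearMap.comp_apply,
      Matrix.cons_val_zero, Matrix.cons_val_one, Matrix.cons_val]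
    simp
    field_simp
    linear_combination 2 * c * (c ^ 2 + 1) * Complex.I *
      ((stdCoframe 1 p u : ℂ) * stdCoframe 2 p v -
        (stdCoframe 1 p v : ℂ) * stdCoframe 2 p u) * hx2
  · intro p v hv
    simp only [conjForm, coframeComb_apply, ContinuousLinearMap.comp_apply, stdCoframe_xiEndo,
      Matrix.cons_val_zero, Matrix.cons_val_one, Matrix.cons_val]
    simp
    field_simp
    linear_combination x * (1 - c ^ 2) * (stdCoframe 2 p v : ℂ) * hI

theorem mean_const {r : ℝ} (hr : r ≠ 0) (w : ℝ) :
    mean (r • stdCoframe 0) (fun _ => w) = w := by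
  have h : ((volume : Measure C2).toSphere).real Set.univ ≠ 0 := by
    rw [Measure.real, ENNReal.toReal_ne_zero]
    exact ⟨Measure.measure_univ_ne_zero.2 (Measure.toSphere_ne_zero _), measure_ne_top _ _⟩
  simp only [mean, contactDensity_smul_stdCoframe, integral_const, smul_eq_mul]
  field_simp

/-! ## The homogeneous solution of the flow -/

/-- The coefficient `c` of the solution starting at Rossi's structure with parameter `t`. -/
def flowC (b t s : ℝ) : ℝ :=
  (1 - t * Real.exp (-2 * s / b ^ 2)) / (1 + t * Real.exp (-2 * s / b ^ 2))

theorem abs_mul_exp_lt {b t s : ℝ} (ht : |t| < 1) (hs : 0 ≤ s) :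
    |t * Real.exp (-2 * s / b ^ 2)| < 1 := by
  have h : Real.exp (-2 * s / b ^ 2) ≤ 1 :=
    Real.exp_le_one_iff.2 (div_nonpos_of_nonpos_of_nonneg (by linarith) (sq_nonneg b))
  rw [abs_mul, abs_of_pos (Real.exp_pos _)]
  exact (mul_le_of_le_one_right (abs_nonneg t) h).trans_lt ht

theorem one_add_pos_of_abs {x : ℝ} (h : |x| < 1) : 0 < 1 + x ∧ 0 < 1 - x := by
  obtain ⟨h1, h2⟩ := abs_lt.1 h
  constructor <;> linarith

theorem flowC_pos {b t s : ℝ} (ht : |t| < 1) (hs : 0 ≤ s) : 0 < flowC b t s :=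
  div_pos (one_add_pos_of_abs (abs_mul_exp_lt ht hs)).2
    (one_add_pos_of_abs (abs_mul_exp_lt ht hs)).1

theorem flowC_zero (b t : ℝ) : flowC b t 0 = (1 - t) / (1 + t) := by
  simp [flowC]

/-- The right-hand side is twice the `X₂ ↦ X₃` coefficient of the torsion in
`isTanakaWebster_diagJ`. Writing `c = (1-τ)/(1+τ)` linearizes this Riccati equation to `τ' =
-2τ/b²`. -/
theorem hasDerivAt_flowC {b t s : ℝ} (hb : b ≠ 0) (ht : |t| < 1) (hs : 0 ≤ s) :
    HasDerivAt (flowC b t) ((1 - flowC b t s ^ 2) / b ^ 2) s := by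
  have h1 := (one_add_pos_of_abs (abs_mul_exp_lt (b := b) ht hs)).1.ne'
  have h2 : HasDerivAt (fun r => t * Real.exp (-2 * r / b ^ 2))
      (t * (Real.exp (-2 * s / b ^ 2) * (-2 * 1 / b ^ 2))) s :=
    ((((hasDerivAt_id s).const_mul (-2)).div_const (b ^ 2)).exp).const_mul t
  have h3 := (h2.const_sub 1).div (h2.const_add 1) h1
  refine h3.congr_deriv ?_
  unfold flowC
  generalize Real.exp (-2 * s / b ^ 2) = e at h1 ⊢
  field_simp
  ring

theorem contDiffOn_flowC {b t : ℝ} (ht : |t| < 1) :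
    ContDiffOn ℝ ∞ (flowC b t) (Set.Ici 0) := by
  have h : ContDiff ℝ ∞ fun s : ℝ => t * Real.exp (-2 * s / b ^ 2) := by fun_prop
  exact (contDiff_const.sub h).contDiffOn.div (contDiff_const.add h).contDiffOn
    fun s hs => (one_add_pos_of_abs (abs_mul_exp_lt ht hs)).1.ne'

theorem tendsto_flowC {b : ℝ} (t : ℝ) (hb : 0 < b) : Tendsto (flowC b t) atTop (𝓝 1) := by
  have h : Tendsto (fun s : ℝ => t * Real.exp (-2 * s / b ^ 2)) atTop (𝓝 (t * 0)) := by
    refine (Real.tendsto_exp_atBot.comp ?_).const_mul t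
    have : Tendsto (fun s : ℝ => (-2 / b ^ 2) * s) atTop atBot :=
      tendsto_id.const_mul_atTop_of_neg (div_neg_of_neg_of_pos (by norm_num) (by positivity))
    exact this.congr fun s => by ring
  have h1 := (h.const_sub 1).div (h.const_add 1) (by simp)
  simp only [mul_zero, sub_zero, add_zero, div_one] at h1
  exact h1

theorem isHomogeneousFlow_flowC {b t : ℝ} (hb : 0 < b) (ht : |t| < 1) :
    IsHomogeneousFlow (Set.Ici 0) (fun s => diagJ (flowC b t s))
      (fun _ => b ^ 2 • stdCoframe 0) := by
  refine ⟨⟨?_, ?_, ?_, ?_⟩, fun s hs => ⟨0, b, _, isHomogeneousCR_diagJ hb (flowC_pos ht hs)⟩⟩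
  · have hc : ContMDiffOn (𝓘(ℝ, ℝ).prod (𝓡 3)) 𝓘(ℝ, ℝ) ∞ (fun x : ℝ × S3 => flowC b t x.1)
        (Set.Ici 0 ×ˢ Set.univ) :=
      (contDiffOn_flowC ht).contMDiffOn.comp contMDiff_fst.contMDiffOn fun x hx => hx.1
    have hc' : ContMDiffOn (𝓘(ℝ, ℝ).prod (𝓡 3)) 𝓘(ℝ, ℝ) ∞ (fun x : ℝ × S3 => -(flowC b t x.1)⁻¹)
        (Set.Ici 0 ×ˢ Set.univ) :=
      ((contDiffOn_flowC ht).inv fun s hs => (flowC_pos ht hs).ne').neg.contMDiffOn.comp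
        contMDiff_fst.contMDiffOn fun x hx => hx.1
    have hM (α β : ℝ) : ContMDiffOn (𝓘(ℝ, ℝ).prod (𝓡 3)) 𝓘(ℝ, C2 →L[ℝ] C2) ∞
        (fun x : ℝ × S3 => xiEndo α β x.2) (Set.Ici 0 ×ˢ Set.univ) :=
      ((isXiEndo_xiEndo α β).smooth.comp contMDiff_snd).contMDiffOn
    -- Time enters only through the two scalar coefficients of fixed endomorphism fields.
    refine ((hc.smul (hM 1 0)).add (hc'.smul (hM 0 1))).congr fun x _ => ?_
    simp [diagJ, xiEndo]
  · exact ((smoothS3_smul_stdCoframe (b ^ 2)).comp contMDiff_snd).contMDiffOn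
  · exact fun s hs => isPseudohermitian_diagJ (flowC_pos ht hs) (by positivity)
  · intro s hs
    refine ⟨_, _, isTanakaWebster_diagJ hb (flowC_pos ht hs), fun p => ⟨?_, ?_⟩⟩
    · have hd := (hasDerivAt_flowC hb.ne' ht hs).hasDerivWithinAt (s := Set.Ici 0)
      have hc := (flowC_pos (b := b) ht hs).ne'
      refine ((hd.smul_const _).add ((hd.inv hc).neg.smul_const _)).congr_deriv ?_
      unfold xiEndo
      rw [smul_add, smul_smul, smul_smul]
      congr 2
      · field_simp
      · field_simp
    -- The curvature is constant, hence equal to its mean, and the contact form is stationary.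
    · rw [mean_const (by positivity), sub_self, mul_zero, zero_smul]
      exact hasDerivWithinAt_const _ _ _

theorem smoothTendsto_const {V : Type} [NormedAddCommGroup V] [NormedSpace ℝ V] (f : S3 → V) :
    SmoothTendsto (fun _ => f) f := fun m => by
  rw [Metric.tendstoUniformlyOn_iff]
  intro ε hε
  simp [hε]

theorem SmoothS3.exists_bound_iteratedFDeriv {V : Type} [NormedAddCommGroup V]
    [NormedSpace ℝ V] {f : S3 → V} (hf : SmoothS3 f) (m : ℕ) :
    ∃ K, ∀ x ∈ sphere (0 : C2) 1, ‖iteratedFDeriv ℝ m (fun y => f (retr y)) x‖ ≤ K := by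
  refine (isCompact_sphere (0 : C2) 1).exists_bound_of_continuousOn fun x hx => ?_
  have h := hf.contDiffAt_retr (ne_zero_of_mem_unit_sphere ⟨x, hx⟩)
  exact (h.iteratedFDeriv_right (m := 0) (i := m)
    (by simpa using WithTop.coe_le_coe.2 (le_top : (m : ℕ∞) ≤ ⊤))).continuousAt.continuousWithinAt

/-- For combinations of two fixed fields, convergence of the coefficients suffices, because each
derivative of a fixed field is bounded on the compact sphere. -/
theorem smoothTendsto_combination {V : Type} [NormedAddCommGroup V] [NormedSpace ℝ V]
    {f g : S3 → V} (hf : SmoothS3 f) (hg : SmoothS3 g) {a b : ℝ → ℝ} {a₀ b₀ : ℝ}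
    (ha : Tendsto a atTop (𝓝 a₀)) (hb : Tendsto b atTop (𝓝 b₀)) :
    SmoothTendsto (fun s p => a s • f p + b s • g p) (fun p => a₀ • f p + b₀ • g p) := by
  intro m
  obtain ⟨K, hK⟩ := hf.exists_bound_iteratedFDeriv m
  obtain ⟨L, hL⟩ := hg.exists_bound_iteratedFDeriv m
  have key (α β : ℝ) (x : C2) (hx : x ∈ sphere (0 : C2) 1) :
      iteratedFDeriv ℝ m (fun y : C2 => α • f (retr y) + β • g (retr y)) x =
        α • iteratedFDeriv ℝ m (fun y => f (retr y)) x +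
          β • iteratedFDeriv ℝ m (fun y => g (retr y)) x := by
    have hx0 : x ≠ 0 := ne_zero_of_mem_unit_sphere ⟨x, hx⟩
    have h1 : ContDiffAt ℝ m (fun y => f (retr y)) x :=
      (hf.contDiffAt_retr hx0).of_le (by exact_mod_cast le_top)
    have h2 : ContDiffAt ℝ m (fun y => g (retr y)) x :=
      (hg.contDiffAt_retr hx0).of_le (by exact_mod_cast le_top)
    rw [fun_iteratedFDeriv_add_apply (h1.const_smul α) (h2.const_smul β),
      iteratedFDeriv_const_smul_apply' h1, iteratedFDeriv_const_smul_apply' h2]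
  rw [Metric.tendstoUniformlyOn_iff]
  intro ε hε
  have hlim : Tendsto (fun s => |a₀ - a s| * K + |b₀ - b s| * L) atTop (𝓝 0) := by
    have := (((ha.const_sub a₀).abs).mul_const K).add (((hb.const_sub b₀).abs).mul_const L)
    simpa using this
  filter_upwards [hlim.eventually_lt_const hε] with s hs x hx
  refine lt_of_le_of_lt ?_ hs
  rw [dist_eq_norm, key _ _ x hx, key _ _ x hx, add_sub_add_comm, ← sub_smul, ← sub_smul]
  refine (norm_add_le _ _).trans ?_
  rw [norm_smul, norm_smul]
  exact add_le_add (mul_le_mul_of_nonneg_left (hK x hx) (abs_nonneg _))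
    (mul_le_mul_of_nonneg_left (hL x hx) (abs_nonneg _))

theorem smoothTendsto_diagJ {c : ℝ → ℝ} (hc : Tendsto c atTop (𝓝 1)) :
    SmoothTendsto (fun s => diagJ (c s)) stdJ := by
  have h (α β : ℝ) : xiEndo α β = fun p => α • xiEndo 1 0 p + β • xiEndo 0 1 p := by
    funext p
    simp [xiEndo]
  have h1 := smoothTendsto_combination (isXiEndo_xiEndo 1 0).smooth (isXiEndo_xiEndo 0 1).smooth
    hc (hc.inv₀ one_ne_zero).neg
  simp only [stdJ_eq, diagJ, h _ (-_)]
  exact h1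

/-! ## Torsion of a homogeneous structure -/

theorem extD_smul {g : S3 → ℂ} {η : Form ℂ} (hg : SmoothS3 g) (hη : SmoothS3 η) {p : S3}
    {u v : C2} (hu : u ∈ tangent p) (hv : v ∈ tangent p) :
    extD (fun q => g q • η q) p u v =
      g p * extD η p u v + (fnD g p u * η p v - fnD g p v * η p u) := by
  have h1 := hg.differentiableAt_retr p
  have h2 := hη.differentiableAt_retr p
  have h3 (w z : C2) : fnD (fun q => g q • η q) p w z =
      g p * fnD η p w z + fnD g p w * η p z := by
    unfold fnD
    rw [fderiv_fun_smul h1 h2]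
    simp [retr_coe]
  rw [extD_eq_fnD (h1.smul h2) hu hv, extD_eq_fnD h2 hu hv, h3, h3]
  ring

theorem IsHomogeneousCR.form_eq_smul {a b c : ℝ} {J : Endo} {θ : Form ℝ}
    (h : IsHomogeneousCR stdCoframe stdC a b c J θ) : θ = b ^ 2 • stdCoframe 0 :=
  form_ext (fun p v hv => by simpa using h.form_eq p v hv) fun p => by
    simp [h.pseudohermitian.normal p, stdCoframe_self]

theorem IsHomogeneousCR.apply_quat_one {a b c : ℝ} {J : Endo} {θ : Form ℝ}
    (h : IsHomogeneousCR stdCoframe stdC a b c J θ) (p : S3) :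
    J p (quat 1 (p : C2)) = a • quat 1 (p : C2) + c • quat 2 (p : C2) := by
  have h1 := quat_one_mem_xi p
  rw [xi_expansion (h.pseudohermitian.cr.maps_xi p _ h1), h.coeff_two p _ h1,
    h.coeff_three p _ h1]
  simp [stdCoframe_quat]

/-- A unitary coframe of type `(1,0)` is a multiple of `ω² + m ω³` with `m = (i - a) / c`. -/
theorem IsHomogeneousCR.coframe_eq {a b c : ℝ} {J : Endo} {θ : Form ℝ}
    (h : IsHomogeneousCR stdCoframe stdC a b c J θ) {θ1 : Form ℂ}
    (htype : ∀ p, ∀ v ∈ xi p, θ1 p (J p v) = Complex.I * θ1 p v)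
    (hunit : ∀ p, ∀ u ∈ tangent p, ∀ v ∈ tangent p,
      ((extD θ p u v : ℝ) : ℂ) = Complex.I * wedgeC θ1 (conjForm θ1) p u v) (p : S3) :
    θ1 p (quat 1 (p : C2)) ≠ 0 ∧ ∀ v ∈ tangent p, θ1 p v =
      θ1 p (quat 1 (p : C2)) / 2 * coframeComb ![0, 1, (Complex.I - a) / c] p v := by
  set m : ℂ := (Complex.I - a) / c with hm
  have hc : (c : ℂ) ≠ 0 := by exact_mod_cast h.c_pos.ne'
  have h2 : θ1 p (quat 2 (p : C2)) = m * θ1 p (quat 1 (p : C2)) := by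
    have := htype p _ (quat_one_mem_xi p)
    rw [h.apply_quat_one, map_add, map_smul, map_smul, Complex.real_smul,
      Complex.real_smul] at this
    rw [hm]
    field_simp
    linear_combination this
  have hmm : (starRingEnd ℂ) m - m ≠ 0 := by
    have : (starRingEnd ℂ) m - m = -(2 * Complex.I) / c := by
      rw [hm]
      simp
      ring
    rw [this]
    simp [hc]
  have hθ := h.form_eq_smul
  have hd (i j : Fin 3) := hunit p _ (quat_mem_tangent i p) _ (quat_mem_tangent j p)
  have h12 := hd 1 2
  have h01 := hd 0 1
  have h02 := hd 0 2
  rw [hθ, extD_smul_stdCoframe _ (quat_mem_tangent _ p) (quat_mem_tangent _ p)] at h12 h01 h02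
  simp [wedgeR, wedgeC, stdCoframe_quat, conjForm, h2] at h12 h01 h02
  have hy : θ1 p (quat 1 (p : C2)) ≠ 0 := by
    intro h0
    simp [h0, h.b_pos.ne'] at h12
  -- Since `ip` lies in the kernel of `dθ`, unitarity forces `θ¹(ip) = 0`: eliminating between the
  -- pairings with `jp` and `kp` leaves the nonzero factor `m̄ - m`.
  have hz : θ1 p (quat 0 (p : C2)) = 0 := by
    have : θ1 p (quat 0 (p : C2)) * ((starRingEnd ℂ) (θ1 p (quat 1 (p : C2))) *
        ((starRingEnd ℂ) m - m)) = 0 := by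
      linear_combination h02 - m * h01
    have h3 : (starRingEnd ℂ) (θ1 p (quat 1 (p : C2))) * ((starRingEnd ℂ) m - m) ≠ 0 :=
      mul_ne_zero ((map_ne_zero _).2 hy) hmm
    exact (mul_eq_zero.1 this).resolve_right h3
  refine ⟨hy, fun v hv => ?_⟩
  conv_lhs => rw [tangent_expansion hv]
  rw [map_add, map_add, map_smul, map_smul, map_smul, hz, h2, coframeComb_apply]
  simp only [Complex.real_smul, Matrix.cons_val_zero, Matrix.cons_val_one, Matrix.cons_val]
  push_cast
  ring

/-- This holds for arbitrary Tanaka-Webster data, whose coframe `g(ω² + mω³)` may have a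
non-constant `g`. The phase of `g` cancels against that of the torsion coefficient, so no invariance
theorem for the torsion is needed. -/
theorem IsHomogeneousCR.torsion_eq {a b c : ℝ} {J : Endo} {θ : Form ℝ}
    (h : IsHomogeneousCR stdCoframe stdC a b c J θ) {A : Endo} {W : S3 → ℝ}
    (hA : IsTanakaWebster J θ A W) (p : S3) :
    (stdCoframe 1 p (A p (quat 1 (p : C2))) : ℂ) +
      (Complex.I - a) / c * stdCoframe 2 p (A p (quat 1 (p : C2))) =
      -(Complex.I * c * (1 + ((Complex.I - a) / c) ^ 2) / b ^ 2) := by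
  obtain ⟨hAx, θ1, φ, α, hθ1, -, htype, hunit, hd, -, -, htor⟩ := hA
  have hco := h.coframe_eq htype hunit
  set m : ℂ := (Complex.I - a) / c with hm
  have hc : (c : ℂ) ≠ 0 := by exact_mod_cast h.c_pos.ne'
  have hb : (b : ℂ) ≠ 0 := by exact_mod_cast h.b_pos.ne'
  let g : S3 → ℂ := fun q => θ1 q (quat 1 (q : C2)) / 2
  have hg : SmoothS3 g := by
    have h1 : SmoothS3 fun q : S3 => θ1 q (quat 1 (q : C2)) :=
      hθ1.clm_apply (smoothS3_restrict (quat 1).contDiff)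
    exact (contDiff_id.div_const (2 : ℂ)).contMDiff.comp h1
  have hext : extD θ1 p = extD (fun q => g q • coframeComb ![0, 1, m] q) p :=
    extD_congr (fun q v hv => (hco q).2 v hv) p
  have hg1 : θ1 p (quat 1 (p : C2)) = 2 * g p := by
    simp only [g]
    ring
  have hg0 : g p ≠ 0 := by
    intro h0
    exact (hco p).1 (by rw [hg1, h0, mul_zero])
  have hg2 : ∀ v ∈ tangent p, θ1 p v = g p * coframeComb ![0, 1, m] p v := (hco p).2
  have hE (i : Fin 3) := hd p _ (quat_mem_tangent 0 p) _ (quat_mem_tangent i p)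
  have E1 := hE 1
  have E2 := hE 2
  rw [hext, extD_smul hg (smoothS3_coframeComb _) (quat_mem_tangent _ p) (quat_mem_tangent _ p),
    extD_coframeComb _ (quat_mem_tangent _ p) (quat_mem_tangent _ p)] at E1 E2
  have q0 := hg2 _ (quat_mem_tangent 0 p)
  have q1 := hg2 _ (quat_mem_tangent 1 p)
  have q2 := hg2 _ (quat_mem_tangent 2 p)
  have qA := hg2 _ (xi_le_tangent (hAx.maps_xi p _ (quat_one_mem_xi p)))
  have hT := htor p _ (quat_one_mem_xi p)
  simp only [coframeComb_apply, stdCoframe_quat, Matrix.cons_val_zero, Matrix.cons_val_one,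
    Matrix.cons_val] at q0 q1 q2
  simp at q0 q1 q2
  rw [qA, coframeComb_apply] at hT
  simp [conjForm, q1] at hT
  simp [h.form_eq_smul, wedgeC, wedgeR, toC, conjForm, q0, q1, q2, coframeComb_apply,
    stdCoframe_quat] at E1 E2
  have hmm : m - (starRingEnd ℂ) m = 2 * Complex.I / c := by
    rw [hm]
    simp
    ring
  rw [map_ofNat] at hT E1 E2
  -- The combination `m E1 - E2` of the structure equation on `(ip, jp)` and `(ip, kp)` eliminates
  -- both `dg(ip)` and `φ(ip)`.
  have hfin : g p * (1 + m ^ 2) = α p * b ^ 2 * (starRingEnd ℂ) (g p) * (2 * Complex.I / c) := by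
    rw [← hmm]
    linear_combination (m * E1 - E2) / 4
  refine mul_left_cancel₀ hg0 ?_
  rw [hT]
  calc α p * ((starRingEnd ℂ) (g p) * 2)
      = -(Complex.I * c / b ^ 2) * (α p * b ^ 2 * (starRingEnd ℂ) (g p) * (2 * Complex.I / c)) := by
        field_simp
        linear_combination α p * (starRingEnd ℂ) (g p) * Complex.I_sq
    _ = g p * -(Complex.I * c * (1 + m ^ 2) / b ^ 2) := by
        rw [← hfin]
        ring

/-! ## Uniqueness of homogeneous solutions -/

theorem eqOn_of_hasDerivWithinAt_zero {E : Type*} [NormedAddCommGroup E] [NormedSpace ℝ E]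
    {I : Set ℝ} (hI : Convex ℝ I) {f : ℝ → E} (hf : ∀ s ∈ I, HasDerivWithinAt f 0 I s)
    {r s : ℝ} (hr : r ∈ I) (hs : s ∈ I) : f s = f r := by
  have := hI.norm_image_sub_le_of_norm_hasDerivWithin_le (f' := fun _ => 0) (C := 0) hf
    (by simp) hr hs
  rw [zero_mul, norm_le_zero_iff, sub_eq_zero] at this
  exact this

section Uniqueness

variable {T : ℝ} {J : ℝ → Endo} {θ : ℝ → Form ℝ}

/-- The value `θ_r(iq) = 2b_r²` does not depend on `q`, so neither does its time derivative. This
makes `W` constant on the sphere, hence equal to its mean. -/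
theorem IsHomogeneousFlow.form_hasDerivWithinAt_zero (h : IsHomogeneousFlow (Set.Ico 0 T) J θ)
    {s : ℝ} (hs : s ∈ Set.Ico 0 T) (p : S3) :
    HasDerivWithinAt (fun r => θ r p) 0 (Set.Ico 0 T) s := by
  obtain ⟨A, W, -, hev⟩ := h.1.evolution s hs
  obtain ⟨a, b, c, hab⟩ := h.2 s hs
  have hb : 0 < b ^ 2 := by
    have := hab.b_pos
    positivity
  have hval (r : ℝ) (hr : r ∈ Set.Ico 0 T) (q : S3) :
      θ r q (quat 0 (q : C2)) = θ r p (quat 0 (p : C2)) := by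
    obtain ⟨a', b', c', hab'⟩ := h.2 r hr
    simp [hab'.form_eq_smul, stdCoframe_quat]
  have hud : UniqueDiffWithinAt ℝ (Set.Ico 0 T) s := uniqueDiffOn_Ico 0 T s hs
  have hder (q : S3) : HasDerivWithinAt (fun r => θ r p (quat 0 (p : C2)))
      (-2 * (W q - mean (θ s) W) * (b ^ 2 * 2)) (Set.Ico 0 T) s := by
    have h1 := (hev q).2.clm_apply (hasDerivWithinAt_const s (Set.Ico 0 T) (quat 0 (q : C2)))
    have h2 := h1.congr (fun r hr => (hval r hr q).symm) (hval s hs q).symm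
    refine h2.congr_deriv ?_
    simp [hab.form_eq_smul, stdCoframe_quat]
  have hW : W = fun _ => W p := by
    funext q
    have := hud.eq_deriv _ (hder q) (hder p)
    have h3 := mul_right_cancel₀ (by positivity : b ^ 2 * 2 ≠ 0) this
    linarith
  have hm : mean (θ s) W = W p := by
    conv_lhs => rw [hW]
    rw [hab.form_eq_smul, mean_const hb.ne']
  have := (hev p).2
  rwa [hm, sub_self, mul_zero, zero_smul] at this

theorem IsHomogeneousFlow.form_eq (h : IsHomogeneousFlow (Set.Ico 0 T) J θ)
    {s : ℝ} (hs : s ∈ Set.Ico 0 T) : θ s = θ 0 := by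
  funext p
  exact eqOn_of_hasDerivWithinAt_zero (convex_Ico 0 T)
    (fun r hr => h.form_hasDerivWithinAt_zero hr p) ⟨le_rfl, hs.1.trans_lt hs.2⟩ hs

/-- The parameters are only given separately for each time. Reading them off at one fixed point
makes them functions of `s` that can be differentiated. -/
theorem IsHomogeneousFlow.homogeneous_of_initial (h : IsHomogeneousFlow (Set.Ico 0 T) J θ)
    {b : ℝ} (hb : 0 < b) (h0 : θ 0 = b ^ 2 • stdCoframe 0) (p : S3)
    {s : ℝ} (hs : s ∈ Set.Ico 0 T) :
    IsHomogeneousCR stdCoframe stdC (stdCoframe 1 p (J s p (quat 1 (p : C2))) / 2) b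
      (stdCoframe 2 p (J s p (quat 1 (p : C2))) / 2) (J s) (θ s) := by
  obtain ⟨a, b', c, hab⟩ := h.2 s hs
  have e := hab.form_eq_smul
  rw [h.form_eq hs, h0] at e
  have e1 : b ^ 2 * 2 = b' ^ 2 * 2 := by
    simpa [stdCoframe_quat] using congrArg (fun η : Form ℝ => η p (quat 0 (p : C2))) e
  have e2 : b = b' := (sq_eq_sq₀ hb.le hab.b_pos.le).1 (by linarith)
  rw [hab.apply_quat_one]
  simpa [stdCoframe_quat, e2] using hab

theorem IsHomogeneousFlow.eq_flowC {b t : ℝ} (hb : 0 < b) (ht : |t| < 1)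
    (h : IsHomogeneousFlow (Set.Ico 0 T) J θ) (hJ0 : J 0 = diagJ ((1 - t) / (1 + t)))
    (h0 : θ 0 = b ^ 2 • stdCoframe 0) {s : ℝ} (hs : s ∈ Set.Ico 0 T) :
    J s = diagJ (flowC b t s) := by
  obtain ⟨ht1, ht2⟩ := one_add_pos_of_abs ht
  let p : S3 := retr 0
  let a : ℝ → ℝ := fun r => stdCoframe 1 p (J r p (quat 1 (p : C2))) / 2
  let c : ℝ → ℝ := fun r => stdCoframe 2 p (J r p (quat 1 (p : C2))) / 2
  have hH (r : ℝ) (hr : r ∈ Set.Ico 0 T) :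
      IsHomogeneousCR stdCoframe stdC (a r) b (c r) (J r) (θ r) :=
    h.homogeneous_of_initial hb h0 p hr
  let m : ℝ → ℂ := fun r => (Complex.I - a r) / c r
  have hb' : (b : ℂ) ≠ 0 := by exact_mod_cast hb.ne'
  -- The imaginary part of `m` is `1/c > 0`.
  have hmI (r : ℝ) (hr : r ∈ Set.Ico 0 T) : m r + Complex.I ≠ 0 := by
    intro h1
    have h2 := congrArg Complex.im h1
    have hc := (hH r hr).c_pos
    simp only [m, Complex.add_im, Complex.div_ofReal_im, Complex.sub_im, Complex.I_im,
      Complex.ofReal_im, sub_zero, Complex.zero_im] at h2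
    have : 0 < 1 / c r := by positivity
    linarith
  have hm' (r : ℝ) (hr : r ∈ Set.Ico 0 T) : HasDerivWithinAt m
      (Complex.I * (1 + m r ^ 2) / b ^ 2) (Set.Ico 0 T) r := by
    obtain ⟨A, W, hA, hev⟩ := h.1.evolution r hr
    have hc : (c r : ℂ) ≠ 0 := by exact_mod_cast (hH r hr).c_pos.ne'
    have htor := (hH r hr).torsion_eq hA p
    have hJ := (hev p).1.clm_apply (hasDerivWithinAt_const r (Set.Ico 0 T) (quat 1 (p : C2)))
    have hω (i : Fin 3) : HasDerivWithinAt
        (fun r' => ((stdCoframe i p (J r' p (quat 1 (p : C2))) / 2 : ℝ) : ℂ))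
        ((stdCoframe i p (A p (quat 1 (p : C2))) : ℝ) : ℂ) (Set.Ico 0 T) r := by
      have h1 := ((stdCoframe i p).hasFDerivAt.comp_hasDerivWithinAt r hJ).div_const 2
      refine (h1.ofReal_comp).congr_deriv ?_
      simp
    have h2 := ((hω 1).const_sub Complex.I).div (hω 2) hc
    refine h2.congr_deriv ?_
    change (stdCoframe 1 p (A p (quat 1 (p : C2))) : ℂ) +
      m r * stdCoframe 2 p (A p (quat 1 (p : C2))) =
      -(Complex.I * c r * (1 + m r ^ 2) / b ^ 2) at htor
    have h3 : Complex.I * (1 + m r ^ 2) / b ^ 2 =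
        -(stdCoframe 1 p (A p (quat 1 (p : C2))) +
          m r * stdCoframe 2 p (A p (quat 1 (p : C2)))) / c r := by
      rw [htor]
      field_simp
    rw [h3]
    simp only [m]
    change (-_ * (c r : ℂ) - (Complex.I - a r) * _) / (c r : ℂ) ^ 2 = _
    field_simp
    ring
  -- The Cayley transform of `m` decays like `exp(-2r/b²)`, so this product is a conserved quantity;
  -- its initial value is `t`.
  let τ : ℝ → ℂ := fun r => (m r - Complex.I) / (m r + Complex.I) *
    Complex.exp (((2 / b ^ 2 * r : ℝ)) : ℂ)
  have hτ' (r : ℝ) (hr : r ∈ Set.Ico 0 T) : HasDerivWithinAt τ 0 (Set.Ico 0 T) r := by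
    have h1 : HasDerivWithinAt (fun r : ℝ => Complex.exp (((2 / b ^ 2 * r : ℝ)) : ℂ))
        (Complex.exp (((2 / b ^ 2 * r : ℝ)) : ℂ) * ((2 / b ^ 2 * 1 : ℝ) : ℂ)) (Set.Ico 0 T) r :=
      (((hasDerivAt_id r).const_mul (2 / b ^ 2)).ofReal_comp.cexp).hasDerivWithinAt
    have h2 := (((hm' r hr).sub_const Complex.I).div ((hm' r hr).add_const Complex.I)
      (hmI r hr)).mul h1
    refine h2.congr_deriv ?_
    have h3 := hmI r hr
    simp only [Pi.div_apply]
    push_cast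
    field_simp
    linear_combination Complex.exp (2 * r / b ^ 2) * 2 * m r ^ 2 * Complex.I_sq
  have hτ := eqOn_of_hasDerivWithinAt_zero (convex_Ico 0 T) hτ' ⟨le_rfl, hs.1.trans_lt hs.2⟩ hs
  have hm0 : m 0 = Complex.I * (1 + t) / (1 - t) := by
    simp only [m, a, c, hJ0, diagJ, stdCoframe_xiEndo]
    simp [stdCoframe_quat, div_div_eq_mul_div]
  have hτ0 : τ 0 = t := by
    simp only [τ, hm0]
    have : (1 - t : ℂ) ≠ 0 := by exact_mod_cast ht2.ne'
    have h1 : Complex.I * (1 + t) / (1 - t) - Complex.I = 2 * Complex.I * t / (1 - t) := by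
      field_simp
      ring
    have h2 : Complex.I * (1 + t) / (1 - t) + Complex.I = 2 * Complex.I / (1 - t) := by
      field_simp
      ring
    rw [h1, h2, mul_zero, Complex.ofReal_zero, Complex.exp_zero]
    field_simp
  have hms : m s * (1 - t * Real.exp (-2 * s / b ^ 2) : ℝ) =
      Complex.I * (1 + t * Real.exp (-2 * s / b ^ 2) : ℝ) := by
    rw [hτ0] at hτ
    have h1 := hmI s hs
    have h2 : (Real.exp (-2 * s / b ^ 2) : ℂ) * Complex.exp (((2 / b ^ 2 * s : ℝ)) : ℂ) = 1 := by
      rw [← Complex.ofReal_exp, ← Complex.ofReal_mul, ← Real.exp_add]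
      rw [show -2 * s / b ^ 2 + 2 / b ^ 2 * s = 0 by ring, Real.exp_zero, Complex.ofReal_one]
    have h3 : (m s - Complex.I) * Complex.exp (((2 / b ^ 2 * s : ℝ)) : ℂ) =
        t * (m s + Complex.I) := by
      rw [← hτ]
      simp only [τ]
      field_simp
    rw [Complex.ofReal_sub, Complex.ofReal_add, Complex.ofReal_mul, Complex.ofReal_one]
    linear_combination (Real.exp (-2 * s / b ^ 2) : ℂ) * h3 - (m s - Complex.I) * h2
  obtain ⟨hT1, hT2⟩ := one_add_pos_of_abs (abs_mul_exp_lt (b := b) ht hs.1)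
  have hc := (hH s hs).c_pos
  have hac : a s = 0 ∧ c s = flowC b t s := by
    have h1 := congrArg Complex.re hms
    have h2 := congrArg Complex.im hms
    simp only [m, Complex.re_mul_ofReal, Complex.im_mul_ofReal, Complex.div_ofReal_re,
      Complex.div_ofReal_im, Complex.sub_re, Complex.sub_im, Complex.I_re, Complex.I_im,
      Complex.ofReal_re, Complex.ofReal_im, zero_sub, sub_zero, zero_mul, one_mul] at h1 h2
    unfold flowC
    generalize t * Real.exp (-2 * s / b ^ 2) = x at h1 h2 hT1 hT2 ⊢
    constructor
    · have := (mul_eq_zero.1 h1).resolve_right hT2.ne'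
      field_simp at this
      linarith
    · field_simp at h2 ⊢
      linarith
  have hs1 := hH s hs
  rw [hac.1, hac.2] at hs1
  have hs2 := isHomogeneousCR_diagJ hb (flowC_pos (b := b) ht hs.1)
  refine hs1.pseudohermitian.cr.toIsXiEndo.ext hs2.pseudohermitian.cr.toIsXiEndo ?_ ?_ <;>
    intro q v hv
  · rw [hs1.coeff_two q v hv, hs2.coeff_two q v hv]
  · rw [hs1.coeff_three q v hv, hs2.coeff_three q v hv]

end Uniqueness

/-! ## Integration by parts on a spherical shell -/

/-- The closed spherical shell `1 ≤ ‖x‖ ≤ 2`. -/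
def shell : Set C2 := closedBall 0 2 \ ball 0 1

theorem mem_shell {x : C2} : x ∈ shell ↔ 1 ≤ ‖x‖ ∧ ‖x‖ ≤ 2 := by
  simp [shell, and_comm]

theorem isCompact_shell : IsCompact shell := (isCompact_closedBall 0 2).diff isOpen_ball

theorem ne_zero_of_mem_shell {x : C2} (hx : x ∈ shell) : x ≠ 0 := by
  rintro rfl
  have := (mem_shell.1 hx).1
  rw [norm_zero] at this
  linarith

/-- The rotation `exp (s qᵢ)`. -/
def rot (i : Fin 3) (s : ℝ) : C2 ≃ₗᵢ[ℝ] C2 :=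
  LinearIsometry.toLinearIsometryEquiv
    { toLinearMap := Real.cos s • LinearMap.id + Real.sin s • (quat i).toLinearMap
      norm_map' := fun x => by
        refine (sq_eq_sq₀ (norm_nonneg _) (norm_nonneg _)).1 ?_
        simp [norm_add_sq_real, norm_smul, norm_quat, inner_smul_left, inner_smul_right,
          inner_quat_self, mul_pow]
        rw [← add_mul, Real.cos_sq_add_sin_sq, one_mul] } rfl

theorem rot_apply (i : Fin 3) (s : ℝ) (x : C2) :
    rot i s x = Real.cos s • x + Real.sin s • quat i x := rfl

theorem rot_mem_shell (i : Fin 3) (s : ℝ) {x : C2} : rot i s x ∈ shell ↔ x ∈ shell := by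
  rw [mem_shell, mem_shell, LinearIsometryEquiv.norm_map]

theorem hasDerivAt_rot (i : Fin 3) (s : ℝ) (x : C2) :
    HasDerivAt (fun r => rot i r x) (quat i (rot i s x)) s := by
  have h := ((Real.hasDerivAt_cos s).smul_const x).add
    ((Real.hasDerivAt_sin s).smul_const (quat i x))
  refine h.congr_deriv ?_
  rw [rot_apply, map_add, map_smul, map_smul, quat_sq, smul_neg, neg_smul]
  abel

theorem integral_shell_comp_rot (h : C2 → ℂ) (i : Fin 3) (s : ℝ) :
    ∫ x in shell, h (rot i s x) = ∫ x in shell, h x := by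
  have := (rot i s).measurePreserving.setIntegral_preimage_emb
    (rot i s).toHomeomorph.measurableEmbedding h shell
  have e : (rot i s) ⁻¹' shell = shell := Set.ext fun x => rot_mem_shell i s
  rwa [e] at this

theorem continuousOn_fderiv_quat {h : C2 → ℂ} (hh : ∀ x ≠ 0, ContDiffAt ℝ ∞ h x) (i : Fin 3) :
    ContinuousOn (fun x => fderiv ℝ h x (quat i x)) shell := fun x hx =>
  ((((hh x (ne_zero_of_mem_shell hx)).fderiv_right (m := 0) (by simp)).continuousAt).clm_apply
    (quat i).continuous.continuousAt).continuousWithinAt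

theorem integrableOn_shell {h : C2 → ℂ} (hh : ContinuousOn h shell) : IntegrableOn h shell :=
  hh.integrableOn_compact isCompact_shell

/-- The rotations `exp(s qᵢ)` preserve the shell and Lebesgue measure, so the integral of `h ∘ exp(s
qᵢ)` is constant in `s`; it is differentiated under the integral at `s = 0`. One bound on the shell
dominates for all `s`. -/
theorem integral_shell_fderiv_quat {h : C2 → ℂ} (hh : ∀ x ≠ 0, ContDiffAt ℝ ∞ h x) (i : Fin 3) :
    ∫ x in shell, fderiv ℝ h x (quat i x) = 0 := by
  have hm : MeasurableSet shell := isCompact_shell.isClosed.measurableSet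
  have hc : ContinuousOn h shell := fun x hx =>
    (hh x (ne_zero_of_mem_shell hx)).continuousAt.continuousWithinAt
  have hd := continuousOn_fderiv_quat hh i
  obtain ⟨K, hK⟩ := isCompact_shell.exists_bound_of_continuousOn hd
  have hrot (g : C2 → ℂ) (hg : ContinuousOn g shell) (s : ℝ) :
      ContinuousOn (fun x => g (rot i s x)) shell :=
    hg.comp (rot i s).continuous.continuousOn fun x hx => (rot_mem_shell i s).2 hx
  have key := (hasDerivAt_integral_of_dominated_loc_of_deriv_le (μ := volume.restrict shell)
    (F := fun s x => h (rot i s x))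
    (F' := fun s x => fderiv ℝ h (rot i s x) (quat i (rot i s x))) (x₀ := (0 : ℝ))
    (bound := fun _ => K) (s := Set.univ) univ_mem
    (Eventually.of_forall fun s => (hrot h hc s).aestronglyMeasurable hm)
    (integrableOn_shell (hrot h hc 0)) ((hrot _ hd 0).aestronglyMeasurable hm)
    ((ae_restrict_iff' hm).2 <| Eventually.of_forall fun x hx s _ =>
      hK _ ((rot_mem_shell i s).2 hx))
    (continuousOn_const.integrableOn_compact isCompact_shell)
    ((ae_restrict_iff' hm).2 <| Eventually.of_forall fun x hx s _ =>
      (((hh _ (ne_zero_of_mem_shell ((rot_mem_shell i s).2 hx))).differentiableAt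
        (by simp)).hasFDerivAt.comp_hasDerivAt s (hasDerivAt_rot i s x)))).2
  simp only [integral_shell_comp_rot h i, rot_apply i 0, Real.cos_zero, Real.sin_zero, one_smul,
    zero_smul, add_zero] at key
  exact key.unique (hasDerivAt_const _ _)

/-! ## Eigenfunctions of the Cauchy-Riemann operator -/

/-- The Cauchy-Riemann operator `D_j + i c D_k`, applied to `h`. -/
def crOp (c : ℝ) (h : C2 → ℂ) (x : C2) : ℂ :=
  fderiv ℝ h x (quat 1 x) + Complex.I * c * fderiv ℝ h x (quat 2 x)

theorem crOp_mul (c : ℝ) {g h : C2 → ℂ} {x : C2} (hg : DifferentiableAt ℝ g x)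
    (hh : DifferentiableAt ℝ h x) :
    crOp c (fun y => g y * h y) x = crOp c g x * h x + g x * crOp c h x := by
  simp only [crOp, fderiv_fun_mul hg hh]
  simp
  ring

theorem integral_shell_crOp (c : ℝ) {h : C2 → ℂ} (hh : ∀ x ≠ 0, ContDiffAt ℝ ∞ h x) :
    ∫ x in shell, crOp c h x = 0 := by
  unfold crOp
  rw [integral_add (integrableOn_shell (continuousOn_fderiv_quat hh 1))
    ((integrableOn_shell (continuousOn_fderiv_quat hh 2)).const_mul _), integral_const_mul,
    integral_shell_fderiv_quat hh, integral_shell_fderiv_quat hh, mul_zero, add_zero]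

/-- `g` is a smooth eigenfunction of `crOp c` with eigenvalue `i λ n`, and has parity `n`. -/
structure IsEigen (c l : ℝ) (n : ℤ) (g : C2 → ℂ) : Prop where
  smooth : ContDiff ℝ ∞ g
  eigen : ∀ x, crOp c g x = Complex.I * l * n * g x
  parity : ∀ x, g (-x) = (-1) ^ n * g x

theorem IsEigen.mul {c l : ℝ} {n k : ℤ} {g h : C2 → ℂ} (hg : IsEigen c l n g)
    (hh : IsEigen c l k h) : IsEigen c l (n + k) (fun x => g x * h x) where
  smooth := hg.smooth.mul hh.smooth
  eigen x := by
    rw [crOp_mul c (hg.smooth.differentiable (by simp) x) (hh.smooth.differentiable (by simp) x),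
      hg.eigen, hh.eigen]
    push_cast
    ring
  parity x := by
    rw [hg.parity, hh.parity, zpow_add₀ (by norm_num)]
    ring

theorem isEigen_one (c l : ℝ) : IsEigen c l 0 (fun _ => 1) where
  smooth := contDiff_const
  eigen x := by simp [crOp]
  parity x := by simp

/-- The transpose of the Cauchy-Riemann operator on linear functions. -/
def crLin (c : ℝ) (ℓ : C2 →L[ℝ] ℂ) : C2 →L[ℝ] ℂ :=
  ℓ.comp (quat 1) + (Complex.I * c) • ℓ.comp (quat 2)

theorem isEigen_linear {c l : ℝ} {ε : ℤ} (hε : Odd ε) {ℓ : C2 →L[ℝ] ℂ}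
    (h : crLin c ℓ = (Complex.I * l * ε) • ℓ) : IsEigen c l ε ℓ where
  smooth := ℓ.contDiff
  eigen x := by
    have := congrArg (fun k : C2 →L[ℝ] ℂ => k x) h
    simpa [crOp, crLin] using this
  parity x := by
    rw [map_neg, hε.neg_one_zpow, neg_one_mul]

/-- The mixed terms cancel because `jk = -kj`. -/
theorem crLin_crLin (c : ℝ) (ℓ : C2 →L[ℝ] ℂ) :
    crLin c (crLin c ℓ) = (-(1 - c ^ 2 : ℝ) : ℂ) • ℓ := by
  ext x
  simp [crLin, quat_sq, quat_one_two, quat_two_one]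
  linear_combination -(c : ℂ) ^ 2 * ℓ x * Complex.I_sq

/-- `crLin c / (il)` is an involution, and the witnesses are its two spectral projections applied to
`ℓ`. -/
theorem exists_eigen_decomposition {c l : ℝ} (hl : 0 < l) (hcl : l ^ 2 = 1 - c ^ 2)
    (ℓ : C2 →L[ℝ] ℂ) : ∃ u w : C2 →L[ℝ] ℂ, ℓ = u + w ∧
      crLin c u = (Complex.I * l * (1 : ℤ)) • u ∧ crLin c w = (Complex.I * l * (-1 : ℤ)) • w := by
  have hl' : (l : ℂ) ≠ 0 := by exact_mod_cast hl.ne'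
  have hadd (a b : ℂ) (u w : C2 →L[ℝ] ℂ) :
      crLin c (a • u + b • w) = a • crLin c u + b • crLin c w := by
    ext x
    simp [crLin]
    ring
  have h2 := crLin_crLin c ℓ
  rw [← hcl] at h2
  refine ⟨(2⁻¹ : ℂ) • ℓ + (-(Complex.I / (2 * l))) • crLin c ℓ,
    (2⁻¹ : ℂ) • ℓ + (Complex.I / (2 * l)) • crLin c ℓ, ?_, ?_, ?_⟩
  · ext x
    simp
    ring
  · rw [hadd, h2]
    ext x
    simp
    field_simp
    linear_combination (crLin c ℓ x) * Complex.I_sq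
  · rw [hadd, h2]
    ext x
    simp
    field_simp
    linear_combination (crLin c ℓ x) * Complex.I_sq

/-! ## Odd solutions of the Cauchy-Riemann equation vanish -/

/-- For even `n` the integrand is odd. For odd `n`, `crOp c (G g) = iln G g` has integral zero, and
`iln ≠ 0`. -/
theorem integral_shell_mul_eigen {c l : ℝ} (hl : 0 < l) {n : ℤ} {g G : C2 → ℂ}
    (hg : IsEigen c l n g) (hG : ∀ x ≠ 0, ContDiffAt ℝ ∞ G x) (hodd : ∀ x, G (-x) = -G x)
    (hcr : ∀ x ≠ 0, crOp c G x = 0) : ∫ x in shell, G x * g x = 0 := by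
  rcases Int.even_or_odd n with hn | hn
  · have h1 : ∫ x in shell, G (-x) * g (-x) = ∫ x in shell, G x * g x := by
      have := (LinearIsometryEquiv.neg ℝ (E := C2)).measurePreserving.setIntegral_preimage_emb
        (Homeomorph.neg C2).measurableEmbedding (fun x => G x * g x) shell
      have e : (LinearIsometryEquiv.neg ℝ (E := C2)) ⁻¹' shell = shell :=
        Set.ext fun x => by simp [mem_shell]
      rw [e] at this
      simpa using this
    simp only [hodd, hg.parity, hn.neg_one_zpow, one_mul, neg_mul] at h1
    rw [integral_neg] at h1
    exact self_eq_neg.1 h1.symm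
  · have hn0 : (n : ℂ) ≠ 0 := by
      rintro h
      rw [Int.cast_eq_zero.1 h] at hn
      exact absurd hn (by decide)
    have h1 := integral_shell_crOp c (h := fun x => G x * g x)
      fun x hx => (hG x hx).mul hg.smooth.contDiffAt
    have h2 : ∫ x in shell, crOp c (fun x => G x * g x) x =
        ∫ x in shell, (Complex.I * l * n) * (G x * g x) := by
      refine setIntegral_congr_fun isCompact_shell.isClosed.measurableSet fun x hx => ?_
      have hx0 := ne_zero_of_mem_shell hx
      rw [crOp_mul c ((hG x hx0).differentiableAt (by simp))
        (hg.smooth.differentiable (by simp) x), hcr x hx0, hg.eigen]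
      ring
    rw [h2, integral_const_mul] at h1
    have hl' : (l : ℂ) ≠ 0 := by exact_mod_cast hl.ne'
    exact (mul_eq_zero.1 h1).resolve_left (by simp [hl', hn0])

/-- The restriction of a linear function to the shell. -/
def shellLin (ℓ : C2 →L[ℝ] ℂ) : C(shell, ℂ) := ⟨fun x => ℓ x, by fun_prop⟩

/-- Linear functions are sums of linear eigenfunctions, so the algebra is spanned by products of
these, and such products are eigenfunctions again. -/
theorem adjoin_shellLin_le_span {c l : ℝ} (hl : 0 < l) (hcl : l ^ 2 = 1 - c ^ 2)
    {a : C(shell, ℂ)} (ha : a ∈ Algebra.adjoin ℂ (Set.range shellLin)) :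
    a ∈ Submodule.span ℂ {m : C(shell, ℂ) | ∃ n g, IsEigen c l n g ∧ ∀ x : shell, m x = g x} := by
  let E : Set C(shell, ℂ) := shellLin '' {ℓ | ∃ ε : ℤ, Odd ε ∧ crLin c ℓ = (Complex.I * l * ε) • ℓ}
  have h1 : Algebra.adjoin ℂ (Set.range shellLin) ≤ Algebra.adjoin ℂ E := by
    refine Algebra.adjoin_le ?_
    rintro _ ⟨ℓ, rfl⟩
    obtain ⟨u, w, rfl, hu, hw⟩ := exists_eigen_decomposition hl hcl ℓ
    have e : shellLin (u + w) = shellLin u + shellLin w := by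
      ext x
      simp [shellLin]
    rw [e]
    exact add_mem (Algebra.subset_adjoin ⟨u, ⟨1, odd_one, hu⟩, rfl⟩)
      (Algebra.subset_adjoin ⟨w, ⟨-1, by decide, hw⟩, rfl⟩)
  have h2 : a ∈ Subalgebra.toSubmodule (Algebra.adjoin ℂ E) := h1 ha
  rw [Algebra.adjoin_eq_span] at h2
  refine Submodule.span_mono ?_ h2
  intro m hm
  induction hm using Submonoid.closure_induction with
  | mem m hm =>
    obtain ⟨ℓ, ⟨ε, hε, h⟩, rfl⟩ := hm
    exact ⟨ε, ℓ, isEigen_linear hε h, fun x => rfl⟩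
  | one => exact ⟨0, _, isEigen_one c l, fun x => rfl⟩
  | mul m k _ _ hm hk =>
    obtain ⟨n, g, hg, hmg⟩ := hm
    obtain ⟨n', g', hg', hkg⟩ := hk
    exact ⟨n + n', _, hg.mul hg', fun x => by simp [hmg, hkg]⟩

/-- Stone-Weierstrass: the `ℓ` are only real linear, so the generators are closed under conjugation,
and the coordinates separate points. -/
theorem dense_adjoin_shellLin :
    Dense (Algebra.adjoin ℂ (Set.range shellLin) : Set C(shell, ℂ)) := by
  have : CompactSpace shell := isCompact_iff_compactSpace.1 isCompact_shell
  have hstar : star (Set.range shellLin) ⊆ Set.range shellLin := by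
    rintro a ⟨ℓ, hℓ⟩
    refine ⟨Complex.conjCLE.toContinuousLinearMap.comp ℓ, ?_⟩
    rw [← star_star a, ← hℓ]
    ext x
    simp [shellLin]
  have hsub : (StarAlgebra.adjoin ℂ (Set.range shellLin)).toSubalgebra =
      Algebra.adjoin ℂ (Set.range shellLin) := by
    rw [StarAlgebra.adjoin_toSubalgebra, Set.union_eq_left.2 hstar]
  have hsep : (StarAlgebra.adjoin ℂ (Set.range shellLin)).SeparatesPoints := by
    intro x y hxy
    have hxy' : (x : C2) ≠ y := fun h => hxy (Subtype.ext h)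
    obtain ⟨i, hi⟩ : ∃ i, (x : C2) i ≠ (y : C2) i := by
      by_contra! h
      exact hxy' (PiLp.ext h)
    let ℓ : C2 →L[ℝ] ℂ := (EuclideanSpace.proj i : C2 →L[ℂ] ℂ).restrictScalars ℝ
    exact ⟨shellLin ℓ, ⟨shellLin ℓ, StarAlgebra.subset_adjoin ℂ _ ⟨ℓ, rfl⟩, rfl⟩, hi⟩
  have h := ContinuousMap.starSubalgebra_topologicalClosure_eq_top_of_separatesPoints _ hsep
  rw [← hsub]
  intro a
  have ha : a ∈ (StarAlgebra.adjoin ℂ (Set.range shellLin)).topologicalClosure := by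
    rw [h]
    trivial
  exact ha

theorem odd_crOp_eq_zero {c : ℝ} (hc : c ^ 2 < 1) {G : C2 → ℂ}
    (hG : ∀ x ≠ 0, ContDiffAt ℝ ∞ G x) (hodd : ∀ x, G (-x) = -G x)
    (hcr : ∀ x ≠ 0, crOp c G x = 0) {x : C2} (hx1 : 1 < ‖x‖) (hx2 : ‖x‖ < 2) : G x = 0 := by
  have : CompactSpace shell := isCompact_iff_compactSpace.1 isCompact_shell
  have hm : MeasurableSet shell := isCompact_shell.isClosed.measurableSet
  have hGc : ContinuousOn G shell := fun x hx =>
    (hG x (ne_zero_of_mem_shell hx)).continuousAt.continuousWithinAt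
  let μ : Measure shell := volume.comap Subtype.val
  have : IsFiniteMeasure μ := by
    refine ⟨?_⟩
    rw [(MeasurableEmbedding.subtype_coe hm).comap_apply, Set.image_univ, Subtype.range_coe]
    exact isCompact_shell.measure_lt_top
  -- The conjugate makes the Hermitian product with `a` equal to the bilinear integral of `G a`;
  -- taking `a = v` later gives the integral of `|G|²`.
  let v : C(shell, ℂ) := ⟨fun x => (starRingEnd ℂ) (G x),
    Complex.continuous_conj.comp (continuousOn_iff_continuous_domRestrict.1 hGc)⟩
  have hinner (a : C(shell, ℂ)) : inner ℂ (ContinuousMap.toLp 2 μ ℂ v)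
      (ContinuousMap.toLp 2 μ ℂ a) = ∫ x : shell, G x * a x ∂μ := by
    rw [ContinuousMap.inner_toLp]
    simp [v, mul_comm]
  have hl : 0 < Real.sqrt (1 - c ^ 2) := Real.sqrt_pos.2 (by linarith)
  have hcl : Real.sqrt (1 - c ^ 2) ^ 2 = 1 - c ^ 2 := Real.sq_sqrt (by linarith)
  have hzero : ∀ a : C(shell, ℂ), inner ℂ (ContinuousMap.toLp 2 μ ℂ v)
      (ContinuousMap.toLp 2 μ ℂ a) = 0 := by
    have hcont : Continuous fun a : C(shell, ℂ) => inner ℂ (ContinuousMap.toLp 2 μ ℂ v)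
      (ContinuousMap.toLp 2 μ ℂ a) :=
      continuous_const.inner (ContinuousMap.toLp 2 μ ℂ).continuous
    refine congrFun (Continuous.ext_on dense_adjoin_shellLin hcont continuous_const ?_)
    intro a ha
    have h1 := adjoin_shellLin_le_span hl hcl ha
    clear ha
    induction h1 using Submodule.span_induction with
    | mem m hm' =>
      obtain ⟨n, g, hg, hmg⟩ := hm'
      simp only [hinner, hmg]
      rw [integral_subtype_comap hm (fun x => G x * g x)]
      exact integral_shell_mul_eigen hl hg hG hodd hcr
    | zero => simp
    | add a b _ _ ha hb =>
      simp only at ha hb ⊢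
      rw [map_add, inner_add_right, ha, hb, add_zero]
    | smul r a _ ha =>
      simp only at ha ⊢
      rw [map_smul, inner_smul_right, ha, mul_zero]
  have hself := hzero v
  rw [hinner] at hself
  have hint : ∫ x in shell, ‖G x‖ ^ 2 = 0 := by
    have h1 : ∫ x in shell, ((‖G x‖ ^ 2 : ℝ) : ℂ) = 0 := by
      rw [← hself, ← integral_subtype_comap hm]
      refine integral_congr_ae (Eventually.of_forall fun x => ?_)
      simp [v, Complex.mul_conj, Complex.normSq_eq_norm_sq]
    rw [integral_complex_ofReal] at h1
    exact_mod_cast h1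
  have hint' := (setIntegral_eq_zero_iff_of_nonneg_ae
    (Eventually.of_forall fun x => sq_nonneg ‖G x‖)
    ((hGc.norm.pow 2).integrableOn_compact isCompact_shell)).1 hint
  -- On an open set, continuity upgrades vanishing almost everywhere to vanishing everywhere.
  let U : Set C2 := {x | 1 < ‖x‖ ∧ ‖x‖ < 2}
  have hU : IsOpen U :=
    (isOpen_lt continuous_const continuous_norm).inter (isOpen_lt continuous_norm continuous_const)
  have hUs : U ⊆ shell := fun x hx => mem_shell.2 ⟨hx.1.le, hx.2.le⟩
  have hae : G =ᵐ[volume.restrict U] fun _ => 0 := by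
    filter_upwards [ae_restrict_of_ae_restrict_of_subset hUs hint'] with x hx
    simpa using hx
  exact Measure.eqOn_open_of_ae_eq hae hU (hGc.mono hUs) continuousOn_const ⟨hx1, hx2⟩

/-! ## Non-embeddability -/

theorem retr_smul {r : ℝ} (hr : 0 < r) (x : C2) : retr (r • x) = retr x := by
  rcases eq_or_ne x 0 with rfl | hx
  · rw [smul_zero]
  · apply Subtype.ext
    rw [coe_retr hx, coe_retr (smul_ne_zero hr.ne' hx), norm_smul, Real.norm_of_nonneg hr.le,
      smul_smul]
    congr 1
    field_simp

theorem retr_neg {x : C2} (hx : x ≠ 0) : retr (-x) = -retr x := by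
  apply Subtype.ext
  rw [coe_retr (neg_ne_zero.2 hx), norm_neg, smul_neg, ← coe_retr hx]
  rfl

/-- The extension is homogeneous of degree 0, so its derivative has degree -1, which the linear
field `quat i x` compensates. -/
theorem fderiv_retr_quat (f : S3 → ℂ) {x : C2} (hx : x ≠ 0) (i : Fin 3) :
    fderiv ℝ (fun y => f (retr y)) x (quat i x) = fnD f (retr x) (quat i (retr x : C2)) := by
  have hr : 0 < ‖x‖⁻¹ := inv_pos.2 (norm_pos_iff.2 hx)
  have h := fderiv_comp_smul (𝕜 := ℝ) (f := fun y => f (retr y)) (x := x) ‖x‖⁻¹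
  simp only [retr_smul hr] at h
  rw [h, fnD, coe_retr hx, map_smul, map_smul, smul_apply]

theorem fnD_coord {N : ℕ} {f : S3 → EuclideanSpace ℂ (Fin N)} (hf : SmoothS3 f) (n : Fin N)
    (p : S3) (v : C2) : fnD (fun q => f q n) p v = fnD f p v n := by
  let π : EuclideanSpace ℂ (Fin N) →L[ℝ] ℂ :=
    (EuclideanSpace.proj n : EuclideanSpace ℂ (Fin N) →L[ℂ] ℂ).restrictScalars ℝ
  have h := (π.hasFDerivAt.comp (p : C2) (hf.differentiableAt_retr p).hasFDerivAt).fderiv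
  exact congrArg (fun k : C2 →L[ℝ] ℂ => k v) h

theorem smoothS3_coord {N : ℕ} {f : S3 → EuclideanSpace ℂ (Fin N)} (hf : SmoothS3 f)
    (n : Fin N) : SmoothS3 (fun q => f q n) :=
  ((EuclideanSpace.proj n : EuclideanSpace ℂ (Fin N) →L[ℂ] ℂ).restrictScalars
    ℝ).contDiff.contMDiff.comp hf

/-- A CR function on `(S³, J)`, `J = diagJ c` with `c < 1`, is even. -/
theorem cr_function_even {c : ℝ} (hc : c ^ 2 < 1) {f : S3 → ℂ} (hf : SmoothS3 f)
    (hcr : ∀ p, ∀ v ∈ xi p, fnD f p (diagJ c p v) = Complex.I * fnD f p v) (p : S3) :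
    f (-p) = f p := by
  let H : C2 → ℂ := fun x => f (retr x)
  -- `crOp c` commutes with `x ↦ -x`, so the odd part of a solution is again a solution.
  let G : C2 → ℂ := fun x => H x - H (-x)
  have hH : ∀ x ≠ 0, ContDiffAt ℝ ∞ H x := fun x hx => hf.contDiffAt_retr hx
  have hHn : ∀ x ≠ 0, ContDiffAt ℝ ∞ (fun y => H (-y)) x := fun x hx =>
    (hH (-x) (neg_ne_zero.2 hx)).comp x contDiffAt_id.neg
  have hHcr : ∀ x ≠ 0, crOp c H x = 0 := fun x hx => by
    have h1 := hcr (retr x) _ (quat_one_mem_xi (retr x))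
    rw [diagJ, xiEndo_apply, stdCoframe_quat, stdCoframe_quat] at h1
    simp at h1
    rw [crOp, fderiv_retr_quat f hx, fderiv_retr_quat f hx]
    linear_combination Complex.I * h1 + fnD f (retr x) (quat 1 (retr x : C2)) * Complex.I_sq
  have hGcr : ∀ x ≠ 0, crOp c G x = 0 := fun x hx => by
    have h1 := hHcr x hx
    have h2 := hHcr (-x) (neg_ne_zero.2 hx)
    have hneg : fderiv ℝ (fun y => H (-y)) x = -fderiv ℝ H (-x) := by
      simpa using fderiv_comp_smul (𝕜 := ℝ) (f := H) (x := x) (-1)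
    have h3 : fderiv ℝ G x = fderiv ℝ H x + fderiv ℝ H (-x) := by
      rw [show G = fun y => H y - H (-y) from rfl,
        fderiv_fun_sub ((hH x hx).differentiableAt (by simp))
          ((hHn x hx).differentiableAt (by simp)), hneg, sub_neg_eq_add]
    simp only [crOp, map_neg] at h1 h2
    simp only [crOp, h3, add_apply]
    linear_combination h1 - h2
  have hp : (p : C2) ≠ 0 := ne_zero_of_mem_unit_sphere p
  -- The radius `3/2` puts the point in the interior of the shell; `G` is constant along the ray, so
  -- its value there is the value at `p`.
  have hr : (0 : ℝ) < 3 / 2 := by norm_num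
  have hn : ‖(3 / 2 : ℝ) • (p : C2)‖ = 3 / 2 := by
    rw [norm_smul, norm_eq_of_mem_sphere]
    norm_num
  have hfin := odd_crOp_eq_zero hc (G := G) (x := (3 / 2 : ℝ) • (p : C2))
    (fun x hx => (hH x hx).sub (hHn x hx)) (fun x => by simp [G]) hGcr (by rw [hn]; norm_num)
    (by rw [hn]; norm_num)
  simp only [G, H, ← smul_neg, retr_smul hr, retr_neg hp, retr_coe] at hfin
  exact (sub_eq_zero.1 hfin).symm

theorem not_isEmbeddable_diagJ {c : ℝ} (hc : c ^ 2 < 1) : ¬ IsEmbeddable (diagJ c) := by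
  rintro ⟨N, f, hf, hemb, -, hcr⟩
  let p : S3 := retr 0
  have h : f (-p) = f p := by
    ext n
    refine cr_function_even hc (smoothS3_coord hf n) (fun q v hv => ?_) p
    rw [fnD_coord hf, fnD_coord hf, hcr q v hv]
    rfl
  have h1 : -(p : C2) = p := congrArg Subtype.val (hemb.injective h)
  have h3 : inner ℝ (-(p : C2)) (p : C2) = inner ℝ (p : C2) (p : C2) := by rw [h1]
  rw [inner_neg_left, inner_self_sphere] at h3
  norm_num at h3

end

theorem mainTheorem10 (t : ℝ) (ht : |t| < 1) :
    ∃ J : Endo, IsRossi t J ∧ (∀ J' : Endo, IsRossi t J' → J' = J) ∧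
      IsHomogeneousCR stdCoframe stdC 0 1 ((1 - t) / (1 + t)) J (stdCoframe 0) ∧
      (0 < t → ¬ IsEmbeddable J) ∧
      IsPseudohermitian stdJ (stdCoframe 0) ∧ IsEmbeddable stdJ ∧
      ∀ b : ℝ, 0 < b → ∃ (Js : ℝ → Endo) (θs : ℝ → Form ℝ),
        IsHomogeneousFlow (Set.Ici 0) Js θs ∧
        Js 0 = J ∧ θs 0 = b ^ 2 • stdCoframe 0 ∧
        SmoothTendsto Js stdJ ∧ SmoothTendsto θs (b ^ 2 • stdCoframe 0) ∧
        ∀ (T : ℝ) (Js' : ℝ → Endo) (θs' : ℝ → Form ℝ), 0 < T →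
          IsHomogeneousFlow (Set.Ico 0 T) Js' θs' →
          Js' 0 = J → θs' 0 = b ^ 2 • stdCoframe 0 →
          ∀ s ∈ Set.Ico 0 T, Js' s = Js s ∧ θs' s = θs s := by
  obtain ⟨h1, h2⟩ := one_add_pos_of_abs ht
  have hstd := isPseudohermitian_diagJ (one_pos (α := ℝ)) (one_pos (α := ℝ))
  have hhom := isHomogeneousCR_diagJ (one_pos (α := ℝ)) (div_pos h2 h1)
  rw [one_smul] at hstd
  rw [one_pow, one_smul] at hhom
  refine ⟨diagJ ((1 - t) / (1 + t)), isRossi_diagJ ht, fun J' hJ' => hJ'.eq_diagJ ht, hhom,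
    fun ht0 => not_isEmbeddable_diagJ ?_, stdJ_eq ▸ hstd, isEmbeddable_stdJ, fun b hb => ?_⟩
  · rw [sq_lt_one_iff_abs_lt_one, abs_of_pos (div_pos h2 h1), div_lt_one h1]
    linarith
  · refine ⟨fun s => diagJ (flowC b t s), fun _ => b ^ 2 • stdCoframe 0,
      isHomogeneousFlow_flowC hb ht, by simp only [flowC_zero], rfl,
      smoothTendsto_diagJ (tendsto_flowC t hb), smoothTendsto_const _, ?_⟩
    exact fun T Js' θs' _ h hJ0 hθ0 s hs =>
      ⟨h.eq_flowC hb ht hJ0 hθ0 hs, (h.form_eq hs).trans hθ0⟩
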